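/- Let $n\ge 0$, and let $\mathbf q:\mathbb R^2\to\mathbb C^n$ be a $C^\infty$ solution of the focusing $n$-component NLS equation $\mathrm i\mathbf q_t+\tfrac12\mathbf q_{xx}+\|\mathbf q\|_2^2\,\mathbf q=0$. Put $\sigma_3=\mathrm{diag}(1,-\mathbb I_n)$, $\mathbf Q=\begin{pmatrix}0&\mathbf q^\dagger\\ \mathbf q&0\end{pmatrix}$, $$\mathbf U(\lambda;x,t)=\mathrm i(\lambda\sigma_3+\mathbf Q),\qquad \mathbf V(\lambda;x,t)=\mathrm i\big(\lambda^2\sigma_3+\lambda\mathbf Q-\tfrac12\sigma_3\mathbf Q^2-\tfrac{\mathrm i}{2}\sigma_3\mathbf Q_x\big),$$ and let $\Phi(\lambda;x,t)$ be an $(n+1)\times(n+1)$ matrix, entire in $\lambda\in\mathbb C$ for all real $x,t$, with $\Phi_x=\mathbf U\Phi$ and $\Phi_t=\mathbf V\Phi$. Let $\lambda_1,\dots,\lambda_k\in\mathbb C$ be pairwise distinct with $\lambda_i\ne\lambda_j^*$ for all $i,j$ (in particular non-real), let $r_1,\dots,r_k\ge1$, $N=\sum_i r_i$, and let $\mathbf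 v(\lambda)\in\mathbb C^{n+1}$ be holomorphic near each $\lambda_i$. Set $$\varphi_i^{[j]}(x,t)=\frac1{j!}\Big(\frac{\mathrm d}{\mathrm d\lambda}\Big)^{j}\Phi(\lambda;x,t)\mathbf v(\lambda)\Big|_{\lambda=\lambda_i},\quad 1\le i\le k,\ 0\le j\le r_i-1,$$ $$\mathbf Y_N=\big(\varphi_1^{[0]},\dots,\varphi_1^{[r_1-1]},\dots,\varphi_k^{[0]},\dots,\varphi_k^{[r_k-1]}\big),$$ let $\mathbf M=(\mathbf M_{i,j})_{1\le i,j\le k}$ be the $N\times N$ block matrix whose block $\mathbf M_{i,j}$ has entries, for $0\le s\le r_i-1$, $0\le\ell\le r_j-1$, $$M_{i,j}^{[s,\ell]}=\sum_{p=0}^s\sum_{m=0}^\ell\binom{p+m}{m}\frac{(-1)^m}{(\lambda_j-\lambda_i^*)^{p+m+1}}\big(\varphi_i^{[s-p]}\big)^\dagger\varphi_j^{[\ell-m]},$$ and let $\mathbf D(\lambda)=\mathrm{diag}(\mathbf D_1,\dots,\mathbf D_k)$, where $\mathbf D_s$ is the $r_s\times r_s$ lower triangular matrix with entries $(\lambda-\lambda_s^*)^{-(i-j+1)}$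 for $0\le j\le i\le r_s-1$ and $0$ for $j>i$. Where $\mathbf M$ is invertible, define $$\mathbf T_N(\lambda;x,t)=\mathbb I-\mathbf Y_N\mathbf M^{-1}\mathbf D\,\mathbf Y_N^\dagger,\qquad \mathbf q^{[N]}(x,t)=\mathbf q(x,t)-2\,\mathbf Y_{N,2}\mathbf M^{-1}\mathbf Y_{N,1}^\dagger,$$ where $\mathbf Y_{N,1}$ is the first row of $\mathbf Y_N$ and $\mathbf Y_{N,2}$ consists of its rows $2,\dots,n+1$. Let $\mathbf U^{[N]},\mathbf V^{[N]}$ be $\mathbf U,\mathbf V$ with $\mathbf q$ replaced by $\mathbf q^{[N]}$. Then: (a) If all $\lambda_i$ lie in the open upper half-plane, or all in the open lower half-plane, and $\Phi(\lambda_i;0,0)\mathbf v(\lambda_i)\ne0$ for every $i$, then $\mathbf M(x,t)$ is invertible for all $(x,t)\in\mathbb R^2$. (b) At every $(x,t)$ with $\det\mathbf M(x,t)\neq0$, the function $\mathbf q^{[N]}$ is $C^\infty$ near $(x,t)$ and satisfies the $n$-component NLS equation there, and for every $\lambda\notin\{\lambda_1^*,\dots,\lambda_k^*\}$ one has $$\partial_x\mathbf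 T_N+\mathbf T_N\mathbf U=\mathbf U^{[N]}\mathbf T_N,\qquad \partial_t\mathbf T_N+\mathbf T_N\mathbf V=\mathbf V^{[N]}\mathbf T_N,$$ the matrix $\mathbf T_N\Phi$ solves the new Lax pair, i.e. $(\mathbf T_N\Phi)_x=\mathbf U^{[N]}\mathbf T_N\Phi$ and $(\mathbf T_N\Phi)_t=\mathbf V^{[N]}\mathbf T_N\Phi$, and $\det\mathbf T_N(\lambda;x,t)\ne0$ if also $\lambda\notin\{\lambda_1,\dots,\lambda_k\}$. -/

import Mathlib

open scoped ContDiff Matrix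

noncomputable section

namespace DarbouxNLS

/-- Row and column indices of the `(n+1) × (n+1)` matrices: the first one, then the last `n`. -/
abbrev Idx (n : ℕ) : Type := Unit ⊕ Fin n

/-- `σ₃ = diag(1, -I_n)`. -/
def sigma3 (n : ℕ) : Matrix (Idx n) (Idx n) ℂ := Matrix.fromBlocks 1 0 0 (-1)

/-- `Q = [[0, w†], [w, 0]]` for a column vector `w`. -/
def potential {n : ℕ} (w : Fin n → ℂ) : Matrix (Idx n) (Idx n) ℂ :=
  Matrix.fromBlocks 0 (Matrix.replicateRow Unit (star w)) (Matrix.replicateCol Unit w) 0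

/-- The spatial Lax matrix `U = i (λ σ₃ + Q)`. -/
def laxU {n : ℕ} (q : ℝ → ℝ → Fin n → ℂ) (μ : ℂ) (x t : ℝ) : Matrix (Idx n) (Idx n) ℂ :=
  Complex.I • (μ • sigma3 n + potential (q x t))

/-- The temporal Lax matrix `V = i (λ² σ₃ + λ Q - σ₃ Q² / 2 - i σ₃ Q_x / 2)`. -/
def laxV {n : ℕ} (q : ℝ → ℝ → Fin n → ℂ) (μ : ℂ) (x t : ℝ) : Matrix (Idx n) (Idx n) ℂ :=
  Complex.I • (μ ^ 2 • sigma3 n + μ • potential (q x t)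
    - (1 / 2 : ℂ) • (sigma3 n * potential (q x t) ^ 2)
    - (Complex.I / 2) • (sigma3 n * potential (deriv (fun s : ℝ => q s t) x)))

/-- At the point `(x, t)` the matrix `Ψ` satisfies `Ψ_x = U Ψ` and `Ψ_t = V Ψ`. -/
def SolvesLaxAt {n : ℕ} (q : ℝ → ℝ → Fin n → ℂ) (μ : ℂ)
    (Ψ : ℝ → ℝ → Matrix (Idx n) (Idx n) ℂ) (x t : ℝ) : Prop :=
  (∀ a b, HasDerivAt (fun s : ℝ => Ψ s t a b) ((laxU q μ x t * Ψ x t) a b) x) ∧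
  (∀ a b, HasDerivAt (fun s : ℝ => Ψ x s a b) ((laxV q μ x t * Ψ x t) a b) t)

/-- At the point `(x, t)` the gauge transformation `T` intertwines the Lax pair of `q` with the
Lax pair of `q'`: `T_x + T U[q] = U[q'] T` and `T_t + T V[q] = V[q'] T`. -/
def IntertwinesLaxAt {n : ℕ} (q q' : ℝ → ℝ → Fin n → ℂ) (μ : ℂ)
    (T : ℝ → ℝ → Matrix (Idx n) (Idx n) ℂ) (x t : ℝ) : Prop :=
  (∀ a b, HasDerivAt (fun s : ℝ => T s t a b)
    ((laxU q' μ x t * T x t - T x t * laxU q μ x t) a b) x) ∧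
  (∀ a b, HasDerivAt (fun s : ℝ => T x s a b)
    ((laxV q' μ x t * T x t - T x t * laxV q μ x t) a b) t)

/-- The focusing `n`-component NLS equation `i q_t + q_xx / 2 + ‖q‖₂² q = 0` at `(x, t)`. -/
def SolvesNLSAt {n : ℕ} (q : ℝ → ℝ → Fin n → ℂ) (x t : ℝ) : Prop :=
  Complex.I • deriv (fun s : ℝ => q x s) t
    + (1 / 2 : ℂ) • deriv (fun s : ℝ => deriv (fun y : ℝ => q y t) s) x
    + ((∑ j, ‖q x t j‖ ^ 2 : ℝ) : ℂ) • q x t = 0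

section Darboux

variable {n k : ℕ} (Φ : ℂ → ℝ → ℝ → Matrix (Idx n) (Idx n) ℂ) (v : ℂ → Idx n → ℂ)
  (lam : Fin k → ℂ) (r : Fin k → ℕ)

/-- The Taylor coefficient `φ_i^{[j]} = (1/j!) (d/dλ)^j (Φ(λ;x,t) v(λ))` at `λ = λ_i`. -/
def phi (i : Fin k) (j : ℕ) (x t : ℝ) : Idx n → ℂ :=
  fun a => (1 / (j.factorial : ℂ)) * iteratedDeriv j (fun μ : ℂ => (Φ μ x t *ᵥ v μ) a) (lam i)

/-- `Y_N`: the column with index `(i, j)`, `0 ≤ j < r_i`, is `φ_i^{[j]}`. -/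
def matY (x t : ℝ) : Matrix (Idx n) (Σ i : Fin k, Fin (r i)) ℂ :=
  Matrix.of fun a c => phi Φ v lam c.1 c.2 x t a

/-- The block matrix `M` with entries `M_{i,j}^{[s,ℓ]}`. -/
def matM (x t : ℝ) : Matrix (Σ i : Fin k, Fin (r i)) (Σ i : Fin k, Fin (r i)) ℂ :=
  Matrix.of fun c d =>
    ∑ p ∈ Finset.range ((c.2 : ℕ) + 1), ∑ m ∈ Finset.range ((d.2 : ℕ) + 1),
      ((p + m).choose m : ℂ) * ((-1) ^ m / (lam d.1 - star (lam c.1)) ^ (p + m + 1)) *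
        (star (phi Φ v lam c.1 ((c.2 : ℕ) - p) x t) ⬝ᵥ phi Φ v lam d.1 ((d.2 : ℕ) - m) x t)

/-- `D = diag(D_1, …, D_k)`, `D_s` being the lower triangular `r_s × r_s` Toeplitz matrix with
entries `1 / (λ - λ_s^*)^{i-j+1}` for `j ≤ i` and `0` otherwise. -/
def matD (μ : ℂ) : Matrix (Σ i : Fin k, Fin (r i)) (Σ i : Fin k, Fin (r i)) ℂ :=
  Matrix.blockDiagonal' fun s => Matrix.of fun i j : Fin (r s) =>
    if (j : ℕ) ≤ (i : ℕ) then 1 / (μ - star (lam s)) ^ ((i : ℕ) - (j : ℕ) + 1) else 0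

/-- The Darboux matrix `T_N = I - Y_N M⁻¹ D Y_N†`. -/
def matT (μ : ℂ) (x t : ℝ) : Matrix (Idx n) (Idx n) ℂ :=
  1 - matY Φ v lam r x t * (matM Φ v lam r x t)⁻¹ * matD lam r μ * (matY Φ v lam r x t)ᴴ

/-- The new potential `q^{[N]} = q - 2 Y_{N,2} M⁻¹ Y_{N,1}†`. -/
def newPotential (q : ℝ → ℝ → Fin n → ℂ) (x t : ℝ) : Fin n → ℂ :=
  fun j => q x t j - 2 * ((matY Φ v lam r x t).toRows₂ * (matM Φ v lam r x t)⁻¹ *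
    ((matY Φ v lam r x t).toRows₁)ᴴ) j ()

end Darboux

end DarbouxNLS

end

/-!
The proof is algebraic once two analytic facts are known.

**Analysis.** The Taylor coefficients `φ_i^{[j]}` in the spectral parameter are Cauchy integrals of
`Φ v` over a circle. Grönwall's inequality bounds `Φ v` on that circle, uniformly for `(x, t)` in a
box, so one may differentiate under the integral sign (`hasDerivAt_iteratedDeriv_of_bounded`,
`taylorCoeff_linear_system`). Multiplication by `λ` acts on Taylor coefficients by a Jordan block,
hence, with `Λ` the Jordan matrix `jordan lam r`,
`Y_x = i (σ₃ Y Λ + Q Y)` and `Y_t = i (σ₃ Y Λ² + Q Y Λ + W Y)`, where `V = i (λ² σ₃ + λ Q + W)`.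
The `φ_i^{[j]}` have locally bounded partial derivatives, so they are continuous, and the system
then bootstraps them to smooth functions of `(x, t)` (`contDiff_phi`).

**Sylvester equation.** Pascal's rule turns the double sum defining `M` into
`M Λ - Λ† M = Y† Y` (`sylvester_matM`), and `D(μ) = (μ - Λ†)⁻¹` (`sub_jordan_mul_matD`). Since no
`λ_i` is a `λ_j^*`, such an equation has at most one solution (`eq_of_sylvester`). This yields
`M† = -M` and, after differentiating the equation, `M_x = i Y† σ₃ Y` and
`M_t = i (Y† σ₃ Y Λ + Λ† Y† σ₃ Y + Y† Q Y)`.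

**Invertibility.** If `M c = 0`, then `|Y c|² = c† (M Λ - Λ† M) c = 0`, because `M` is
skew-Hermitian. So `Y` vanishes on `ker M`, which is then stable under `Λ`; an eigenvector of `Λ` in
it is a multiple of a basis vector `(i, 0)`, and `φ_i^{[0]}` would vanish, against uniqueness for
the linear system it solves (`det_ne_zero_of_sylvester`, `phi_zero_ne_zero`).

**Dressing.** For a constant matrix `Z` commuting with `Λ†` put `F_Z = Y M⁻¹ Z Y†` (`dress`), and
`B = F_1`, `B₁ = F_{Λ†}`. Then `Q' = Q + [σ₃, B]` is the matrix of the new potential, and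
`∂_x F_Z = i ([σ₃, F_{ZΛ†}] + Q' F_Z - F_Z Q)`, with a similar formula in `t` in which `W` is
replaced by `W' = W + C`, `C = [σ₃, B₁] + Q' B - B Q`. As `B_x = i C`, the matrix `W'` is exactly
the one built from the new potential (`lowV_newPotential`). The choice `Z = D(μ)` gives the
intertwining relations for `T = 1 - F_D`, and the choices `Z = 1`, `Z = Λ†` show that
`Q_t - W_x + i [Q, W]` is the same for `q` and for the new potential. The lower left block of that
expression is, up to a factor `-i`, the left-hand side of the NLS equation.
-/

namespace DarbouxNLS

open Filter Topology Metric Set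

/-! ### Analytic preliminaries -/

/-- Two-sided form of Grönwall's inequality for a homogeneous linear differential inequality. -/
theorem norm_le_mul_exp_of_norm_deriv_le {E : Type*} [NormedAddCommGroup E] [NormedSpace ℝ E]
    {f f' : ℝ → E} {K a b : ℝ} (hf : ∀ s ∈ uIcc a b, HasDerivAt f (f' s) s)
    (hK : ∀ s ∈ uIcc a b, ‖f' s‖ ≤ K * ‖f s‖) : ‖f b‖ ≤ ‖f a‖ * Real.exp (K * |b - a|) := by
  rcases le_total a b with h | h
  · rw [uIcc_of_le h] at hf hK
    have := norm_le_gronwallBound_of_norm_deriv_right_le (δ := ‖f a‖) (K := K) (ε := 0)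
      (fun s hs => (hf s hs).continuousAt.continuousWithinAt)
      (fun s hs => (hf s (Ico_subset_Icc_self hs)).hasDerivWithinAt) le_rfl
      (fun s hs => by simpa using hK s (Ico_subset_Icc_self hs)) b (right_mem_Icc.2 h)
    rwa [gronwallBound_ε0, ← abs_of_nonneg (sub_nonneg.2 h)] at this
  · rw [uIcc_of_ge h] at hf hK
    have hneg : ∀ s ∈ Icc (-a) (-b), HasDerivAt (fun s => f (-s)) (-f' (-s)) s := fun s hs => by
      have := (hf (-s) ⟨by linarith [hs.2], by linarith [hs.1]⟩).scomp s (hasDerivAt_neg s)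
      simpa using! this
    have := norm_le_gronwallBound_of_norm_deriv_right_le (f := fun s => f (-s)) (δ := ‖f a‖)
      (K := K) (ε := 0)
      (fun s hs => (hneg s hs).continuousAt.continuousWithinAt)
      (fun s hs => (hneg s (Ico_subset_Icc_self hs)).hasDerivWithinAt) (by simp)
      (fun s hs => by
        simpa using hK (-s) ⟨by linarith [hs.2], by linarith [hs.1]⟩) (-b)
      (right_mem_Icc.2 (by linarith))
    rw [gronwallBound_ε0] at this
    rw [abs_sub_comm, abs_of_nonneg (sub_nonneg.2 h)]
    simpa [neg_add_eq_sub] using this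

/-- Higher derivatives in the spectral parameter commute with differentiation in a real parameter:
both are computed by Cauchy's formula on a circle, under which one may differentiate. -/
theorem hasDerivAt_iteratedDeriv_of_bounded {f g : ℂ → ℝ → ℂ} {c : ℂ} {R : ℝ} (hR : 0 < R)
    {s₀ C : ℝ} (j : ℕ) (hf : ∀ s, DifferentiableOn ℂ (fun μ => f μ s) (closedBall c R))
    (hg : DifferentiableOn ℂ (fun μ => g μ s₀) (closedBall c R))
    (hfg : ∀ μ ∈ sphere c R, ∀ s, HasDerivAt (f μ) (g μ s) s)
    (hC : ∀ᶠ s in 𝓝 s₀, ∀ μ ∈ sphere c R, ‖g μ s‖ ≤ C) :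
    HasDerivAt (fun s => iteratedDeriv j (fun μ => f μ s) c)
      (iteratedDeriv j (fun μ => g μ s₀) c) s₀ := by
  have cauchy : ∀ u : ℂ → ℂ, DifferentiableOn ℂ u (closedBall c R) →
      iteratedDeriv j u c = (2 * Real.pi * Complex.I / j.factorial)⁻¹ *
        ∫ θ in (0 : ℝ)..2 * Real.pi, deriv (circleMap c R) θ •
          ((1 / (circleMap c R θ - c) ^ (j + 1)) • u (circleMap c R θ)) := fun u hu => by
    have h2 : (2 * Real.pi * Complex.I / j.factorial : ℂ) ≠ 0 := by
      simp [Nat.factorial_ne_zero]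
    have := hu.circleIntegral_one_div_sub_center_pow_smul hR j
    rw [circleIntegral] at this
    rw [this, smul_eq_mul, inv_mul_cancel_left₀ h2]
  have hmem : ∀ θ, circleMap c R θ ∈ sphere c R := circleMap_mem_sphere c hR.le
  have hcont : ∀ u : ℂ → ℂ, DifferentiableOn ℂ u (closedBall c R) →
      Continuous fun θ : ℝ => deriv (circleMap c R) θ •
          ((1 / (circleMap c R θ - c) ^ (j + 1)) • u (circleMap c R θ)) := fun u hu => by
    have h1 : Continuous fun θ => u (circleMap c R θ) :=
      hu.continuousOn.comp_continuous (continuous_circleMap c R)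
        fun θ => sphere_subset_closedBall (hmem θ)
    have h2 : ∀ θ, (circleMap c R θ - c) ^ (j + 1) ≠ 0 := fun θ =>
      pow_ne_zero _ (sub_ne_zero.2 (circleMap_ne_center hR.ne'))
    simp only [deriv_circleMap]
    have h3 := continuous_circleMap c R
    have h4 := continuous_circleMap 0 R
    exact (h4.mul continuous_const).smul
      ((continuous_const.div ((h3.sub continuous_const).pow _) h2).smul h1)
  simp only [cauchy _ (hf _), cauchy _ hg]
  refine HasDerivAt.const_mul _ ?_
  refine (intervalIntegral.hasDerivAt_integral_of_dominated_loc_of_deriv_le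
    (F := fun s θ => deriv (circleMap c R) θ •
          ((1 / (circleMap c R θ - c) ^ (j + 1)) • f (circleMap c R θ) s))
    (F' := fun s θ => deriv (circleMap c R) θ •
          ((1 / (circleMap c R θ - c) ^ (j + 1)) • g (circleMap c R θ) s))
    (bound := fun _ => R * (1 / R ^ (j + 1) * C)) hC
    (Eventually.of_forall fun s => (hcont _ (hf s)).aestronglyMeasurable)
    ((hcont _ (hf s₀)).intervalIntegrable _ _)
    (hcont _ hg).aestronglyMeasurable ?_ intervalIntegrable_const ?_).2
  · refine Eventually.of_forall fun θ _ s hs => ?_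
    have h1 : ‖circleMap c R θ - c‖ = R := mem_sphere_iff_norm.1 (hmem θ)
    rw [norm_smul, norm_smul, norm_div, norm_pow, h1, norm_one]
    simp only [deriv_circleMap, norm_mul, norm_circleMap_zero, abs_of_pos hR, Complex.norm_I,
      mul_one]
    gcongr
    exact hs _ (hmem θ)
  · refine Eventually.of_forall fun θ _ s _ => ?_
    exact ((hfg _ (hmem θ) s).const_smul (1 / (circleMap c R θ - c) ^ (j + 1))).const_smul
      (deriv (circleMap c R) θ)

/-- A function of two real variables with locally bounded partial derivatives is continuous. -/
theorem continuousAt_of_isBigO_partial {F F₁ F₂ : ℝ → ℝ → ℂ} {z : ℝ × ℝ}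
    (h₁ : ∀ x t, HasDerivAt (fun s => F s t) (F₁ x t) x)
    (h₂ : ∀ x t, HasDerivAt (fun s => F x s) (F₂ x t) t)
    (b₁ : (fun p : ℝ × ℝ => F₁ p.1 p.2) =O[𝓝 z] fun _ => (1 : ℝ))
    (b₂ : (fun p : ℝ × ℝ => F₂ p.1 p.2) =O[𝓝 z] fun _ => (1 : ℝ)) :
    ContinuousAt (fun p : ℝ × ℝ => F p.1 p.2) z := by
  obtain ⟨C₁, hC₁⟩ := b₁.bound
  obtain ⟨C₂, hC₂⟩ := b₂.bound
  obtain ⟨ε, hε, hb⟩ := Metric.eventually_nhds_iff_ball.1 (hC₁.and hC₂)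
  simp only [norm_one, mul_one] at hb
  have hbox : ∀ x ∈ ball z.1 ε, ∀ t ∈ ball z.2 ε, (x, t) ∈ ball z ε := fun x hx t ht => by
    rw [← ball_prod_same]; exact ⟨hx, ht⟩
  have key : ∀ p ∈ ball z ε, ‖F p.1 p.2 - F z.1 z.2‖ ≤ C₁ * ‖p.1 - z.1‖ + C₂ * ‖p.2 - z.2‖ := by
    intro p hp
    rw [← ball_prod_same] at hp
    have e₁ := (convex_ball z.1 ε).norm_image_sub_le_of_norm_hasDerivWithin_le
      (f := fun s => F s p.2) (f' := fun s => F₁ s p.2) (C := C₁)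
      (fun x _ => (h₁ x p.2).hasDerivWithinAt)
      (fun x hx => (hb _ (hbox x hx _ hp.2)).1) (mem_ball_self hε) hp.1
    have e₂ := (convex_ball z.2 ε).norm_image_sub_le_of_norm_hasDerivWithin_le
      (f := fun s => F z.1 s) (f' := fun s => F₂ z.1 s) (C := C₂)
      (fun x _ => (h₂ z.1 x).hasDerivWithinAt)
      (fun x hx => (hb _ (hbox _ (mem_ball_self hε) x hx)).2) (mem_ball_self hε) hp.2
    calc _ = ‖(F p.1 p.2 - F z.1 p.2) + (F z.1 p.2 - F z.1 z.2)‖ := by congr 1; ring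
      _ ≤ _ := (norm_add_le _ _).trans (add_le_add e₁ e₂)
  rw [ContinuousAt, tendsto_iff_norm_sub_tendsto_zero]
  have hlim : Tendsto (fun p : ℝ × ℝ => C₁ * ‖p.1 - z.1‖ + C₂ * ‖p.2 - z.2‖) (𝓝 z) (𝓝 0) := by
    have : Continuous fun p : ℝ × ℝ => C₁ * ‖p.1 - z.1‖ + C₂ * ‖p.2 - z.2‖ := by fun_prop
    simpa using this.tendsto z
  exact squeeze_zero' (Eventually.of_forall fun _ => norm_nonneg _)
    (eventually_of_mem (ball_mem_nhds z hε) key) hlim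

/-- A function with partial derivatives of class `C^m` on the whole plane is of class `C^{m+1}`. -/
theorem contDiff_succ_of_partial {F F₁ F₂ : ℝ → ℝ → ℂ} (m : ℕ)
    (h₁ : ∀ x t, HasDerivAt (fun s => F s t) (F₁ x t) x)
    (h₂ : ∀ x t, HasDerivAt (fun s => F x s) (F₂ x t) t)
    (c₁ : ContDiff ℝ m fun p : ℝ × ℝ => F₁ p.1 p.2)
    (c₂ : ContDiff ℝ m fun p : ℝ × ℝ => F₂ p.1 p.2) :
    ContDiff ℝ (m + 1) fun p : ℝ × ℝ => F p.1 p.2 := by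
  have hd : ∀ p : ℝ × ℝ, HasFDerivAt (fun p : ℝ × ℝ => F p.1 p.2)
      ((ContinuousLinearMap.fst ℝ ℝ ℝ).smulRight (F₁ p.1 p.2) +
        (ContinuousLinearMap.snd ℝ ℝ ℝ).smulRight (F₂ p.1 p.2)) p := fun p => by
    have := hasStrictFDerivAt_uncurry_coprod (𝕜 := ℝ) (u := p) (f := F)
      (f₁ := fun x t => ContinuousLinearMap.toSpanSingleton ℝ (F₁ x t))
      (f₂ := fun x t => ContinuousLinearMap.toSpanSingleton ℝ (F₂ x t))
      (Eventually.of_forall fun v => (h₁ v.1 v.2).hasFDerivAt)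
      (Eventually.of_forall fun v => (h₂ v.1 v.2).hasFDerivAt)
      ((ContinuousLinearMap.toSpanSingletonCLE (𝕜 := ℝ) (E := ℂ)).continuous.comp
        c₁.continuous).continuousAt
      ((ContinuousLinearMap.toSpanSingletonCLE (𝕜 := ℝ) (E := ℂ)).continuous.comp
        c₂.continuous).continuousAt
    refine this.hasFDerivAt.congr_fderiv ?_
    ext <;> simp [Function.HasUncurry.uncurry]
  refine contDiff_succ_iff_hasFDerivAt.2 ⟨_, ?_, hd⟩
  exact (contDiff_const.smulRight c₁).add (contDiff_const.smulRight c₂)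

/-- Bootstrapping: a family of continuous functions on the plane is smooth as soon as its partial
derivatives inherit every finite order of smoothness of the family. -/
theorem contDiff_infty_of_partial {ι : Type*} {F F₁ F₂ : ι → ℝ → ℝ → ℂ}
    (h₁ : ∀ i x t, HasDerivAt (fun s => F i s t) (F₁ i x t) x)
    (h₂ : ∀ i x t, HasDerivAt (fun s => F i x s) (F₂ i x t) t)
    (hc : ∀ i, Continuous fun p : ℝ × ℝ => F i p.1 p.2)
    (hs : ∀ m : ℕ, (∀ i, ContDiff ℝ m fun p : ℝ × ℝ => F i p.1 p.2) → ∀ i,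
      ContDiff ℝ m (fun p : ℝ × ℝ => F₁ i p.1 p.2) ∧
      ContDiff ℝ m (fun p : ℝ × ℝ => F₂ i p.1 p.2)) (i : ι) :
    ContDiff ℝ ∞ fun p : ℝ × ℝ => F i p.1 p.2 := by
  refine contDiff_infty.2 fun m => ?_
  induction m generalizing i with
  | zero => exact contDiff_zero.2 (hc i)
  | succ m ih =>
    exact_mod_cast contDiff_succ_of_partial m (h₁ i) (h₂ i) (hs m ih i).1 (hs m ih i).2

/-! ### Linear systems depending on a parameter -/

theorem norm_mulVec_le {ι : Type*} [Fintype ι] (A : Matrix ι ι ℂ) (w : ι → ℂ) :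
    ‖A *ᵥ w‖ ≤ (∑ a, ∑ b, ‖A a b‖) * ‖w‖ := by
  refine (pi_norm_le_iff_of_nonneg (by positivity)).2 fun a => ?_
  calc ‖(A *ᵥ w) a‖ ≤ ∑ b, ‖A a b * w b‖ := norm_sum_le _ _
    _ ≤ ∑ b, ‖A a b‖ * ‖w‖ := Finset.sum_le_sum fun b _ => by
        rw [norm_mul]; gcongr; exact norm_le_pi_norm w b
    _ = (∑ b, ‖A a b‖) * ‖w‖ := (Finset.sum_mul _ _ _).symm
    _ ≤ _ := by
        refine mul_le_mul_of_nonneg_right ?_ (norm_nonneg w)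
        exact Finset.single_le_sum (f := fun a => ∑ b, ‖A a b‖) (fun _ _ => by positivity)
          (Finset.mem_univ a)

/-- Solutions of a pair of linear systems in `x` and `t` are controlled on a box by their value at
the centre, uniformly in a compact set of parameters. -/
theorem exists_norm_le_mul_of_linear_system {ι : Type*} [Fintype ι]
    {A B : ℂ → ℝ → ℝ → Matrix ι ι ℂ} {h : ℂ → ℝ → ℝ → ι → ℂ} {S : Set ℂ} (hS : IsCompact S)
    (hA : ∀ a b, Continuous fun p : ℂ × ℝ × ℝ => A p.1 p.2.1 p.2.2 a b)
    (hB : ∀ a b, Continuous fun p : ℂ × ℝ × ℝ => B p.1 p.2.1 p.2.2 a b)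
    (hx : ∀ μ ∈ S, ∀ x t, HasDerivAt (fun s => h μ s t) (A μ x t *ᵥ h μ x t) x)
    (ht : ∀ μ ∈ S, ∀ x t, HasDerivAt (fun s => h μ x s) (B μ x t *ᵥ h μ x t) t)
    (x₀ t₀ ρ : ℝ) :
    ∃ K, ∀ μ ∈ S, ∀ x ∈ closedBall x₀ ρ, ∀ t ∈ closedBall t₀ ρ,
      ‖h μ x t‖ ≤ ‖h μ x₀ t₀‖ * K := by
  rcases lt_or_ge ρ 0 with hρ | hρ
  · exact ⟨0, fun μ _ x hx => absurd hx (by simp [closedBall_eq_empty.2 hρ])⟩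
  have hcpt : IsCompact (S ×ˢ closedBall x₀ ρ ×ˢ closedBall t₀ ρ) :=
    hS.prod ((isCompact_closedBall _ _).prod (isCompact_closedBall _ _))
  obtain ⟨a, ha⟩ := hcpt.exists_bound_of_continuousOn
    (f := fun p : ℂ × ℝ × ℝ => ∑ a, ∑ b, ‖A p.1 p.2.1 p.2.2 a b‖)
    (continuous_finsetSum _ fun i _ => continuous_finsetSum _ fun k _ =>
      (hA i k).norm).continuousOn
  obtain ⟨b, hb⟩ := hcpt.exists_bound_of_continuousOn
    (f := fun p : ℂ × ℝ × ℝ => ∑ a, ∑ b, ‖B p.1 p.2.1 p.2.2 a b‖)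
    (continuous_finsetSum _ fun i _ => continuous_finsetSum _ fun k _ =>
      (hB i k).norm).continuousOn
  have hsub : ∀ {y y₀ : ℝ}, y ∈ closedBall y₀ ρ → uIcc y₀ y ⊆ closedBall y₀ ρ := fun hy => by
    rw [← segment_eq_uIcc]
    exact (convex_closedBall _ _).segment_subset (mem_closedBall_self hρ) hy
  refine ⟨Real.exp (|a| * ρ) * Real.exp (|b| * ρ), fun μ hμ x hx' t ht' => ?_⟩
  have e₁ := norm_le_mul_exp_of_norm_deriv_le (K := |a|) (fun s _ => hx μ hμ s t₀)
    (fun s (hs : s ∈ uIcc x₀ x) => (norm_mulVec_le _ _).trans (by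
      gcongr
      exact (le_abs_self _).trans ((ha (μ, s, t₀)
        ⟨hμ, hsub hx' hs, mem_closedBall_self hρ⟩).trans (le_abs_self a))))
  have e₂ := norm_le_mul_exp_of_norm_deriv_le (K := |b|) (fun s _ => ht μ hμ x s)
    (fun s (hs : s ∈ uIcc t₀ t) => (norm_mulVec_le _ _).trans (by
      gcongr
      exact (le_abs_self _).trans ((hb (μ, x, s)
        ⟨hμ, hx', hsub ht' hs⟩).trans (le_abs_self b))))
  rw [mem_closedBall, Real.dist_eq] at hx' ht'
  calc ‖h μ x t‖ ≤ ‖h μ x₀ t₀‖ * Real.exp (|a| * |x - x₀|) * Real.exp (|b| * |t - t₀|) :=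
        e₂.trans (by gcongr)
    _ ≤ ‖h μ x₀ t₀‖ * Real.exp (|a| * ρ) * Real.exp (|b| * ρ) := by gcongr
    _ = _ := mul_assoc _ _ _

/-! ### Taylor coefficients in the spectral parameter -/

/-- The `j`-th Taylor coefficient at `c` of a vector-valued function, taken componentwise. -/
noncomputable def taylorCoeff {ι : Type*} (c : ℂ) (j : ℕ) (h : ℂ → ι → ℂ) : ι → ℂ :=
  fun a => (1 / (j.factorial : ℂ)) * iteratedDeriv j (fun μ => h μ a) c

theorem taylorCoeff_zero {ι : Type*} (c : ℂ) (h : ℂ → ι → ℂ) : taylorCoeff c 0 h = h c := by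
  ext a; simp [taylorCoeff]

theorem taylorCoeff_add {ι : Type*} {c : ℂ} {g h : ℂ → ι → ℂ}
    (hg : ∀ a, AnalyticAt ℂ (fun μ => g μ a) c) (hh : ∀ a, AnalyticAt ℂ (fun μ => h μ a) c)
    (j : ℕ) : taylorCoeff c j (fun μ => g μ + h μ) = taylorCoeff c j g + taylorCoeff c j h := by
  ext a
  simp only [taylorCoeff, Pi.add_apply]
  rw [iteratedDeriv_fun_add (hg a).contDiffAt (hh a).contDiffAt, mul_add]

theorem taylorCoeff_mulVec {ι : Type*} [Fintype ι] {c : ℂ} {h : ℂ → ι → ℂ}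
    (hh : ∀ a, AnalyticAt ℂ (fun μ => h μ a) c) (A : Matrix ι ι ℂ) (j : ℕ) :
    taylorCoeff c j (fun μ => A *ᵥ h μ) = A *ᵥ taylorCoeff c j h := by
  ext a
  simp only [taylorCoeff, Matrix.mulVec_eq_sum, Finset.sum_apply, Pi.smul_apply,
    MulOpposite.smul_eq_mul_unop, MulOpposite.unop_op, Matrix.transpose_apply]
  rw [iteratedDeriv_fun_sum (f := fun b μ => A a b * h μ b)
    fun b _ => contDiffAt_const.mul (hh b).contDiffAt, Finset.mul_sum]
  refine Finset.sum_congr rfl fun b _ => ?_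
  rw [iteratedDeriv_const_mul_field]
  ring

/-- Multiplication by the spectral parameter acts on Taylor coefficients by a Jordan block. -/
theorem taylorCoeff_smul {ι : Type*} {c : ℂ} {h : ℂ → ι → ℂ}
    (hh : ∀ a, AnalyticAt ℂ (fun μ => h μ a) c) (j : ℕ) :
    taylorCoeff c j (fun μ => μ • h μ) =
      c • taylorCoeff c j h + if 0 < j then taylorCoeff c (j - 1) h else 0 := by
  ext a
  have key : ∀ j : ℕ, ∀ᶠ μ in 𝓝 c, iteratedDeriv j (fun μ => μ * h μ a) μ =
      μ * iteratedDeriv j (fun μ => h μ a) μ + j * iteratedDeriv (j - 1) (fun μ => h μ a) μ := by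
    intro j
    induction j with
    | zero => simp
    | succ j ih =>
      filter_upwards [ih.eventually_nhds, (hh a).eventually_analyticAt] with μ hμ ha
      have hd : ∀ m, DifferentiableAt ℂ (iteratedDeriv m fun μ => h μ a) μ := fun m =>
        ((ha.iterated_deriv m).congr (by rw [iteratedDeriv_eq_iterate])).differentiableAt
      have e := ((hasDerivAt_id' μ).fun_mul (hd j).hasDerivAt).fun_add
        ((hd (j - 1)).hasDerivAt.const_mul (j : ℂ))
      rw [iteratedDeriv_succ, Filter.EventuallyEq.deriv_eq hμ, e.deriv, ← iteratedDeriv_succ,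
        ← iteratedDeriv_succ]
      rcases j with _ | j
      · simp; ring
      · simp; ring
  have := (key j).self_of_nhds
  simp only [taylorCoeff, Pi.smul_apply, smul_eq_mul, Pi.add_apply, this]
  rcases j with _ | j
  · simp
  · have : ((j : ℂ) + 1) ≠ 0 := by exact_mod_cast j.succ_ne_zero
    have : (j.factorial : ℂ) ≠ 0 := by exact_mod_cast j.factorial_ne_zero
    simp [Nat.factorial_succ, taylorCoeff]
    field_simp

/-- Taylor coefficients of a solution of a linear system with parameter: they satisfy the system
obtained by expanding in the parameter, and they are locally bounded. -/
theorem taylorCoeff_linear_system {ι : Type*} [Fintype ι]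
    {A B : ℂ → ℝ → ℝ → Matrix ι ι ℂ} {h : ℂ → ℝ → ℝ → ι → ℂ} {c : ℂ} {R : ℝ} (hR : 0 < R)
    (hA : ∀ a b, Continuous fun p : ℂ × ℝ × ℝ => A p.1 p.2.1 p.2.2 a b)
    (hB : ∀ a b, Continuous fun p : ℂ × ℝ × ℝ => B p.1 p.2.1 p.2.2 a b)
    (hAd : ∀ x t a b, Differentiable ℂ fun μ => A μ x t a b)
    (hBd : ∀ x t a b, Differentiable ℂ fun μ => B μ x t a b)
    (hh : ∀ x t a, DifferentiableOn ℂ (fun μ => h μ x t a) (closedBall c R))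
    (hx : ∀ μ ∈ sphere c R, ∀ x t, HasDerivAt (fun s => h μ s t) (A μ x t *ᵥ h μ x t) x)
    (ht : ∀ μ ∈ sphere c R, ∀ x t, HasDerivAt (fun s => h μ x s) (B μ x t *ᵥ h μ x t) t)
    (j : ℕ) (a : ι) (x₀ t₀ : ℝ) :
    HasDerivAt (fun s => taylorCoeff c j (fun μ => h μ s t₀) a)
      (taylorCoeff c j (fun μ => A μ x₀ t₀ *ᵥ h μ x₀ t₀) a) x₀ ∧
    HasDerivAt (fun s => taylorCoeff c j (fun μ => h μ x₀ s) a)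
      (taylorCoeff c j (fun μ => B μ x₀ t₀ *ᵥ h μ x₀ t₀) a) t₀ ∧
    (fun p : ℝ × ℝ => taylorCoeff c j (fun μ => h μ p.1 p.2) a) =O[𝓝 (x₀, t₀)]
      fun _ => (1 : ℝ) := by
  obtain ⟨K, hK⟩ := exists_norm_le_mul_of_linear_system (isCompact_sphere c R) hA hB hx ht x₀ t₀ 1
  obtain ⟨C, hC⟩ := (isCompact_sphere c R).exists_bound_of_continuousOn
    (f := fun μ => h μ x₀ t₀) (continuousOn_pi.2 fun a =>
      (hh x₀ t₀ a).continuousOn.mono sphere_subset_closedBall)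
  have hbd : ∀ μ ∈ sphere c R, ∀ x ∈ closedBall x₀ 1, ∀ t ∈ closedBall t₀ 1,
      ‖h μ x t‖ ≤ C * |K| := fun μ hμ x hx t ht =>
    (hK μ hμ x hx t ht).trans <|
      (mul_le_mul_of_nonneg_left (le_abs_self K) (norm_nonneg _)).trans
        (mul_le_mul_of_nonneg_right (hC μ hμ) (abs_nonneg K))
  have hC0 : 0 ≤ C * |K| := by
    obtain ⟨μ, hμ⟩ := (NormedSpace.sphere_nonempty (x := c)).2 hR.le
    exact (norm_nonneg _).trans (hbd μ hμ x₀ (by simp) t₀ (by simp))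
  have hcpt : IsCompact (sphere c R ×ˢ closedBall x₀ 1 ×ˢ closedBall t₀ 1) :=
    (isCompact_sphere c R).prod ((isCompact_closedBall _ _).prod (isCompact_closedBall _ _))
  have hprod : ∀ G : ℂ → ℝ → ℝ → Matrix ι ι ℂ,
      (∀ a b, Continuous fun p : ℂ × ℝ × ℝ => G p.1 p.2.1 p.2.2 a b) →
      ∃ C', ∀ μ ∈ sphere c R, ∀ x ∈ closedBall x₀ 1, ∀ t ∈ closedBall t₀ 1,
        ‖(G μ x t *ᵥ h μ x t) a‖ ≤ C' := fun G hG => by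
    obtain ⟨b, hb⟩ := hcpt.exists_bound_of_continuousOn
      (f := fun p : ℂ × ℝ × ℝ => ∑ a, ∑ b, ‖G p.1 p.2.1 p.2.2 a b‖)
      (continuous_finsetSum _ fun i _ => continuous_finsetSum _ fun k _ =>
        (hG i k).norm).continuousOn
    refine ⟨|b| * (C * |K|), fun μ hμ x hx t ht => (norm_le_pi_norm _ a).trans <|
      (norm_mulVec_le _ _).trans ?_⟩
    exact mul_le_mul ((le_abs_self _).trans ((hb (μ, x, t) ⟨hμ, hx, ht⟩).trans (le_abs_self b)))
      (hbd μ hμ x hx t ht) (norm_nonneg _) (abs_nonneg _)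
  have hdiff : ∀ G : ℂ → ℝ → ℝ → Matrix ι ι ℂ,
      (∀ x t a b, Differentiable ℂ fun μ => G μ x t a b) →
      DifferentiableOn ℂ (fun μ => (G μ x₀ t₀ *ᵥ h μ x₀ t₀) a) (closedBall c R) := fun G hG => by
    simp only [Matrix.mulVec_eq_sum, Finset.sum_apply, Pi.smul_apply,
      MulOpposite.smul_eq_mul_unop, MulOpposite.unop_op, Matrix.transpose_apply]
    exact DifferentiableOn.fun_sum fun b _ => (hG _ _ _ _).differentiableOn.mul (hh _ _ _)
  refine ⟨HasDerivAt.const_mul _ ?_, HasDerivAt.const_mul _ ?_, ?_⟩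
  · obtain ⟨C', hC'⟩ := hprod A hA
    exact hasDerivAt_iteratedDeriv_of_bounded (f := fun μ s => h μ s t₀ a)
      (g := fun μ s => (A μ s t₀ *ᵥ h μ s t₀) a) hR (C := C') j (fun s => hh s t₀ a)
      (hdiff A hAd) (fun μ hμ s => hasDerivAt_pi.1 (hx μ hμ s t₀) a)
      (eventually_of_mem (closedBall_mem_nhds x₀ one_pos) fun s hs μ hμ =>
        hC' μ hμ s hs t₀ (by simp))
  · obtain ⟨C', hC'⟩ := hprod B hB
    exact hasDerivAt_iteratedDeriv_of_bounded (f := fun μ s => h μ x₀ s a)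
      (g := fun μ s => (B μ x₀ s *ᵥ h μ x₀ s) a) hR (C := C') j (fun s => hh x₀ s a)
      (hdiff B hBd) (fun μ hμ s => hasDerivAt_pi.1 (ht μ hμ x₀ s) a)
      (eventually_of_mem (closedBall_mem_nhds t₀ one_pos) fun s hs μ hμ =>
        hC' μ hμ x₀ (by simp) s hs)
  · refine Asymptotics.IsBigO.of_bound
      (1 / (j.factorial : ℝ) * (j.factorial * (C * |K|) / R ^ j))
      (eventually_of_mem (closedBall_mem_nhds (x₀, t₀) one_pos) fun p hp => ?_)
    rw [← closedBall_prod_same] at hp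
    rw [norm_one, mul_one, taylorCoeff, norm_mul, norm_div, norm_one, Complex.norm_natCast]
    gcongr
    exact Complex.norm_iteratedDeriv_le_of_forall_mem_sphere_norm_le j hR
      ((hh p.1 p.2 a).mono closure_ball_subset_closedBall).diffContOnCl fun μ hμ =>
        (norm_le_pi_norm _ a).trans (hbd μ hμ _ hp.1 _ hp.2)

/-! ### Entrywise calculus for matrices -/

/-- The entries of `A` have the entries of `A'` as derivatives at `s`. -/
def HasEntryDerivAt {m n : Type*} (A : ℝ → Matrix m n ℂ) (A' : Matrix m n ℂ) (s : ℝ) : Prop :=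
  ∀ i j, HasDerivAt (fun y => A y i j) (A' i j) s

/-- The entries of `A` are of class `C^m` at `z`. -/
def EntryContDiffAt {E : Type*} [NormedAddCommGroup E] [NormedSpace ℝ E] {k l : Type*}
    (m : WithTop ℕ∞) (A : E → Matrix k l ℂ) (z : E) : Prop :=
  ∀ i j, ContDiffAt ℝ m (fun p => A p i j) z

namespace HasEntryDerivAt

variable {k l m : Type*} {A : ℝ → Matrix k l ℂ} {A' : Matrix k l ℂ} {s : ℝ}

theorem unique {A'' : Matrix k l ℂ} (h : HasEntryDerivAt A A' s) (h' : HasEntryDerivAt A A'' s) :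
    A' = A'' :=
  Matrix.ext fun i j => (h i j).unique (h' i j)

theorem const (A : Matrix k l ℂ) (s : ℝ) : HasEntryDerivAt (fun _ => A) 0 s :=
  fun _ _ => hasDerivAt_const _ _

theorem add {B : ℝ → Matrix k l ℂ} {B' : Matrix k l ℂ} (h : HasEntryDerivAt A A' s)
    (h' : HasEntryDerivAt B B' s) : HasEntryDerivAt (fun y => A y + B y) (A' + B') s :=
  fun i j => (h i j).add (h' i j)

theorem sub {B : ℝ → Matrix k l ℂ} {B' : Matrix k l ℂ} (h : HasEntryDerivAt A A' s)
    (h' : HasEntryDerivAt B B' s) : HasEntryDerivAt (fun y => A y - B y) (A' - B') s :=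
  fun i j => (h i j).sub (h' i j)

theorem mul [Fintype l] {B : ℝ → Matrix l m ℂ} {B' : Matrix l m ℂ} (h : HasEntryDerivAt A A' s)
    (h' : HasEntryDerivAt B B' s) :
    HasEntryDerivAt (fun y => A y * B y) (A' * B s + A s * B') s := fun i j => by
  simp only [Matrix.mul_apply, Matrix.add_apply, ← Finset.sum_add_distrib]
  exact HasDerivAt.fun_sum fun a _ => (h i a).mul (h' a j)

theorem const_mul [Fintype l] {B : ℝ → Matrix l m ℂ} {B' : Matrix l m ℂ} (A : Matrix k l ℂ)
    (h : HasEntryDerivAt B B' s) : HasEntryDerivAt (fun y => A * B y) (A * B') s := by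
  simpa using (const A s).mul h

theorem mul_const [Fintype l] (h : HasEntryDerivAt A A' s) (B : Matrix l m ℂ) :
    HasEntryDerivAt (fun y => A y * B) (A' * B) s := by
  simpa using h.mul (const B s)

theorem conjTranspose (h : HasEntryDerivAt A A' s) :
    HasEntryDerivAt (fun y => (A y)ᴴ) A'ᴴ s :=
  fun i j => (h j i).star

theorem congr_of_eventuallyEq {B : ℝ → Matrix k l ℂ} (h : HasEntryDerivAt A A' s)
    (hB : ∀ᶠ y in 𝓝 s, B y = A y) : HasEntryDerivAt B A' s :=
  fun i j => (h i j).congr_of_eventuallyEq (hB.mono fun _ hy => congrFun (congrFun hy i) j)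

end HasEntryDerivAt

namespace EntryContDiffAt

variable {E : Type*} [NormedAddCommGroup E] [NormedSpace ℝ E] {k l n : Type*}
  {m : WithTop ℕ∞} {A : E → Matrix k l ℂ} {z : E}

theorem const (A : Matrix k l ℂ) : EntryContDiffAt m (fun _ => A) z :=
  fun _ _ => contDiffAt_const

theorem add {B : E → Matrix k l ℂ} (h : EntryContDiffAt m A z) (h' : EntryContDiffAt m B z) :
    EntryContDiffAt m (fun y => A y + B y) z :=
  fun i j => (h i j).add (h' i j)

theorem sub {B : E → Matrix k l ℂ} (h : EntryContDiffAt m A z) (h' : EntryContDiffAt m B z) :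
    EntryContDiffAt m (fun y => A y - B y) z :=
  fun i j => (h i j).sub (h' i j)

theorem smul {f : E → ℂ} (hf : ContDiffAt ℝ m f z) (h : EntryContDiffAt m A z) :
    EntryContDiffAt m (fun y => f y • A y) z :=
  fun i j => hf.smul (h i j)

theorem mul [Fintype l] {B : E → Matrix l n ℂ} (h : EntryContDiffAt m A z)
    (h' : EntryContDiffAt m B z) : EntryContDiffAt m (fun y => A y * B y) z := fun i j => by
  simp only [Matrix.mul_apply]
  exact ContDiffAt.sum fun a _ => (h i a).mul (h' a j)

theorem conjTranspose (h : EntryContDiffAt m A z) : EntryContDiffAt m (fun y => (A y)ᴴ) z :=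
  fun i j => Complex.conjCLE.contDiff.contDiffAt.comp z (h j i)

theorem det [Fintype k] [DecidableEq k] {A : E → Matrix k k ℂ} (h : EntryContDiffAt m A z) :
    ContDiffAt ℝ m (fun y => (A y).det) z := by
  simp only [Matrix.det_apply]
  exact ContDiffAt.sum fun σ _ => (contDiffAt_prod fun i _ => h (σ i) i).const_smul _

theorem inv [Fintype k] [DecidableEq k] {A : E → Matrix k k ℂ} (h : EntryContDiffAt m A z)
    (hz : (A z).det ≠ 0) : EntryContDiffAt m (fun y => (A y)⁻¹) z := fun i j => by
  simp only [Matrix.inv_def, Matrix.smul_apply, Ring.inverse_eq_inv', Matrix.adjugate_apply]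
  refine (h.det.inv hz).smul (EntryContDiffAt.det fun a b => ?_)
  by_cases hj : a = j
  · simpa [hj] using contDiffAt_const
  · simpa [Matrix.updateRow_apply, hj] using h a b

theorem comp {F : Type*} [NormedAddCommGroup F] [NormedSpace ℝ F] {g : F → E} {w : F}
    (h : EntryContDiffAt m A (g w)) (hg : ContDiffAt ℝ m g w) :
    EntryContDiffAt m (fun y => A (g y)) w :=
  fun i j => (h i j).comp w hg

theorem hasEntryDerivAt {A : ℝ → Matrix k l ℂ} {s : ℝ} (h : EntryContDiffAt m A s) (hm : m ≠ 0) :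
    HasEntryDerivAt A (Matrix.of fun i j => deriv (fun y => A y i j) s) s :=
  fun i j => ((h i j).differentiableAt hm).hasDerivAt

end EntryContDiffAt

/-- Derivative of the inverse of a matrix function. -/
theorem HasEntryDerivAt.inv {k : Type*} [Fintype k] [DecidableEq k] {A : ℝ → Matrix k k ℂ}
    {A' : Matrix k k ℂ} {s : ℝ} (h : HasEntryDerivAt A A' s) {m : WithTop ℕ∞}
    (hA : EntryContDiffAt m A s) (hm : m ≠ 0) (hs : (A s).det ≠ 0) :
    HasEntryDerivAt (fun y => (A y)⁻¹) (-((A s)⁻¹ * A' * (A s)⁻¹)) s := by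
  have h₁ := (hA.inv hs).hasEntryDerivAt hm
  set D : Matrix k k ℂ := Matrix.of fun i j => deriv (fun y => (A y)⁻¹ i j) s
  have hev : ∀ᶠ y in 𝓝 s, (1 : Matrix k k ℂ) = (A y)⁻¹ * A y := by
    filter_upwards [hA.det.continuousAt.eventually_ne hs] with y hy
    rw [Matrix.nonsing_inv_mul _ (isUnit_iff_ne_zero.2 hy)]
  have h₂ := ((h₁.mul h).congr_of_eventuallyEq hev).unique (HasEntryDerivAt.const 1 s)
  have h₃ : D * A s = -((A s)⁻¹ * A') := eq_neg_of_add_eq_zero_left h₂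
  have h₄ : D = -((A s)⁻¹ * A' * (A s)⁻¹) := by
    rw [← Matrix.neg_mul, ← h₃, Matrix.mul_assoc,
      Matrix.mul_nonsing_inv _ (isUnit_iff_ne_zero.2 hs), Matrix.mul_one]
  rwa [← h₄]

/-! ### The Jordan matrix and the Sylvester equation -/

section Jordan

variable {k : ℕ} {lam : Fin k → ℂ} {r : Fin k → ℕ}

/-- The predecessor of an index inside its block; the first index of a block is its own
predecessor. -/
def prevIdx (d : Σ i : Fin k, Fin (r i)) : Σ i : Fin k, Fin (r i) :=
  ⟨d.1, ⟨(d.2 : ℕ) - 1, lt_of_le_of_lt (Nat.sub_le _ _) d.2.2⟩⟩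

/-- The block diagonal matrix of upper triangular Jordan blocks of size `r i` and eigenvalue
`lam i`. -/
def jordan (lam : Fin k → ℂ) (r : Fin k → ℕ) :
    Matrix (Σ i : Fin k, Fin (r i)) (Σ i : Fin k, Fin (r i)) ℂ :=
  Matrix.of fun c d => (if c = d then lam d.1 else 0) +
    if 0 < (d.2 : ℕ) ∧ c = prevIdx d then 1 else 0

theorem mul_jordan_apply {m : Type*} (A : Matrix m (Σ i : Fin k, Fin (r i)) ℂ) (a : m)
    (d : Σ i : Fin k, Fin (r i)) : (A * jordan lam r) a d =
      lam d.1 * A a d + if 0 < (d.2 : ℕ) then A a (prevIdx d) else 0 := by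
  simp only [Matrix.mul_apply, jordan, Matrix.of_apply, mul_add, Finset.sum_add_distrib]
  congr 1
  · simp [mul_comm]
  · split_ifs with h <;> simp [h]

theorem jordan_conjTranspose_mul_apply {m : Type*} (A : Matrix (Σ i : Fin k, Fin (r i)) m ℂ)
    (c : Σ i : Fin k, Fin (r i)) (a : m) : ((jordan lam r)ᴴ * A) c a =
      star (lam c.1) * A c a + if 0 < (c.2 : ℕ) then A (prevIdx c) a else 0 := by
  have := mul_jordan_apply (lam := lam) Aᴴ a c
  rw [← star_inj, ← Matrix.conjTranspose_apply, Matrix.conjTranspose_mul,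
    Matrix.conjTranspose_conjTranspose, this]
  split_ifs <;> simp

theorem jordan_mulVec_apply (w : (Σ i : Fin k, Fin (r i)) → ℂ) (c : Σ i : Fin k, Fin (r i)) :
    (jordan lam r *ᵥ w) c = lam c.1 * w c +
      if h : (c.2 : ℕ) + 1 < r c.1 then w ⟨c.1, ⟨c.2 + 1, h⟩⟩ else 0 := by
  simp only [Matrix.mulVec, dotProduct, jordan, Matrix.of_apply, add_mul, Finset.sum_add_distrib]
  congr 1
  · simp
  · obtain ⟨i, c⟩ := c
    split_ifs with h
    · rw [Finset.sum_eq_single ⟨i, ⟨c + 1, h⟩⟩]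
      · simp [prevIdx]
      · rintro ⟨j, d⟩ - hd
        rw [if_neg, zero_mul]
        rintro ⟨h0, h1⟩
        simp only [prevIdx, Sigma.mk.injEq] at h1
        obtain ⟨rfl, h1⟩ := h1
        refine hd ?_
        have : (c : ℕ) = d - 1 := congrArg Fin.val (eq_of_heq h1)
        simp only [Sigma.mk.injEq, heq_eq_eq, true_and, Fin.ext_iff]
        simp only at h0
        omega
      · simp
    · refine Finset.sum_eq_zero ?_
      rintro ⟨j, d⟩ -
      rw [if_neg, zero_mul]
      rintro ⟨h0, h1⟩
      simp only [prevIdx, Sigma.mk.injEq] at h1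
      obtain ⟨rfl, h1⟩ := h1
      have : (c : ℕ) = d - 1 := congrArg Fin.val (eq_of_heq h1)
      have := d.2
      simp only at h0 h
      omega

/-- The homogeneous Sylvester equation has only the trivial solution, since the two Jordan matrices
have disjoint spectra. -/
theorem eq_zero_of_mul_jordan_eq (hlam : ∀ i j, lam i ≠ star (lam j))
    {X : Matrix (Σ i : Fin k, Fin (r i)) (Σ i : Fin k, Fin (r i)) ℂ}
    (hX : X * jordan lam r = (jordan lam r)ᴴ * X) : X = 0 := by
  have key : ∀ n : ℕ, ∀ c d : Σ i : Fin k, Fin (r i), (c.2 : ℕ) + d.2 = n → X c d = 0 := by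
    intro n
    induction n using Nat.strong_induction_on with
    | _ n ih =>
      intro c d hn
      have h := congrFun (congrFun hX c) d
      rw [mul_jordan_apply, jordan_conjTranspose_mul_apply] at h
      have h₁ : (if 0 < (d.2 : ℕ) then X c (prevIdx d) else 0) = 0 :=
        ite_eq_right_iff.2 fun hd => ih (n - 1) (by omega) _ _ (by simp [prevIdx]; omega)
      have h₂ : (if 0 < (c.2 : ℕ) then X (prevIdx c) d else 0) = 0 :=
        ite_eq_right_iff.2 fun hd => ih (n - 1) (by omega) _ _ (by simp [prevIdx]; omega)
      rw [h₁, h₂, add_zero, add_zero, ← sub_eq_zero, ← sub_mul] at h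
      exact (mul_eq_zero.1 h).resolve_left (sub_ne_zero.2 (hlam _ _))
  exact Matrix.ext fun c d => key _ c d rfl

theorem eq_of_sylvester (hlam : ∀ i j, lam i ≠ star (lam j))
    {X X' : Matrix (Σ i : Fin k, Fin (r i)) (Σ i : Fin k, Fin (r i)) ℂ}
    (hX : X * jordan lam r - (jordan lam r)ᴴ * X = X' * jordan lam r - (jordan lam r)ᴴ * X') :
    X = X' := by
  refine sub_eq_zero.1 (eq_zero_of_mul_jordan_eq hlam ?_)
  rw [Matrix.sub_mul, Matrix.mul_sub]
  rw [sub_eq_sub_iff_add_eq_add] at hX ⊢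
  rw [hX, add_comm]

/-- The recursion, coming from Pascal's rule, behind the Sylvester equation for `matM`. -/
theorem binomial_double_sum_recursion {a : ℂ} (ha : a ≠ 0) (G : ℕ → ℕ → ℂ) (K : ℕ → ℕ → ℂ)
    (hK : ∀ s l, K s l = ∑ p ∈ Finset.range (s + 1), ∑ m ∈ Finset.range (l + 1),
      ((p + m).choose m : ℂ) * ((-1) ^ m / a ^ (p + m + 1)) * G (s - p) (l - m)) (s l : ℕ) :
    a * K s l + (if 0 < l then K s (l - 1) else 0) - (if 0 < s then K (s - 1) l else 0) =
      G s l := by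
  obtain ⟨w, hw⟩ : ∃ w : ℕ → ℕ → ℂ, ∀ p m,
    w p m = ((p + m).choose m : ℂ) * ((-1) ^ m / a ^ (p + m + 1)) := ⟨_, fun _ _ => rfl⟩
  simp only [← hw] at hK
  have w00 : a * w 0 0 = 1 := by rw [hw]; simp; field_simp
  have w0 : ∀ m, a * w 0 (m + 1) = -w 0 m := fun m => by
    rw [hw, hw]; simp; field_simp; ring
  have w1 : ∀ p, a * w (p + 1) 0 = w p 0 := fun p => by
    rw [hw, hw]; simp; field_simp; ring
  have w2 : ∀ p m, a * w (p + 1) (m + 1) = w p (m + 1) - w (p + 1) m := fun p m => by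
    rw [hw, hw, hw, show p + 1 + (m + 1) = (p + m + 1) + 1 by ring, Nat.choose_succ_succ,
      show p + (m + 1) = p + m + 1 by ring, show p + 1 + m = p + m + 1 by ring]
    push_cast
    field_simp
    ring
  rcases s with _ | s <;> rcases l with _ | l
  · simp [hK, ← mul_assoc, w00]
  · simp [hK, Finset.sum_range_succ' _ (l + 1), mul_add, Finset.mul_sum, ← mul_assoc, w00, w0]
  · simp [hK, Finset.sum_range_succ' _ (s + 1), mul_add, Finset.mul_sum, ← mul_assoc, w00, w1]
  · rw [hK (s + 1) (l + 1), hK (s + 1), hK _ (l + 1)]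
    simp only [Finset.sum_range_succ' _ (s + 1), Finset.sum_range_succ' _ (l + 1), mul_add,
      Finset.mul_sum, ← mul_assoc, w00, w0, w1, w2, Finset.sum_add_distrib, sub_mul, neg_mul,
      Finset.sum_sub_distrib, Finset.sum_neg_distrib, Nat.succ_pos, if_true, Nat.add_sub_cancel,
      Nat.add_sub_add_right, Nat.sub_zero, one_mul]
    ring

/-- `matD` is the resolvent of the adjoint Jordan matrix. -/
theorem sub_jordan_mul_matD {μ : ℂ} (hμ : ∀ i, μ ≠ star (lam i)) :
    (μ • 1 - (jordan lam r)ᴴ) * matD lam r μ = 1 := by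
  ext c d
  rw [Matrix.sub_mul, Matrix.sub_apply, jordan_conjTranspose_mul_apply, Matrix.smul_mul,
    Matrix.one_mul, Matrix.smul_apply, smul_eq_mul]
  obtain ⟨i, c⟩ := c
  obtain ⟨j, d⟩ := d
  by_cases hij : i = j
  · subst hij
    have ha : μ - star (lam i) ≠ 0 := sub_ne_zero.2 (hμ i)
    simp only [matD, prevIdx, Matrix.blockDiagonal'_apply_eq, Matrix.of_apply, Matrix.one_apply,
      Sigma.mk.injEq, heq_eq_eq, true_and, Fin.ext_iff]
    rcases lt_trichotomy (d : ℕ) c with h | h | h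
    · rw [if_pos h.le, if_pos (by omega), if_pos (by omega), if_neg (by omega),
        show (c : ℕ) - 1 - d + 1 = c - d by omega]
      field_simp
      ring
    · rw [if_pos h.le, if_pos h.symm, h, Nat.sub_self]
      have : (if 0 < (c : ℕ) then if (c : ℕ) ≤ c - 1 then
          1 / (μ - star (lam i)) ^ ((c : ℕ) - 1 - c + 1) else 0 else 0) = 0 := by
        split_ifs <;> first | omega | rfl
      rw [this]
      field_simp
      ring
    · rw [if_neg (by omega : ¬(d : ℕ) ≤ c), if_neg (by omega : ¬(d : ℕ) ≤ c - 1),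
        if_neg (by omega : ¬(c : ℕ) = d)]
      simp
  · have h1 : (1 : Matrix (Σ i : Fin k, Fin (r i)) (Σ i : Fin k, Fin (r i)) ℂ) ⟨i, c⟩ ⟨j, d⟩ = 0 :=
      Matrix.one_apply_ne fun h => hij (congrArg Sigma.fst h)
    simp only [matD, prevIdx]
    rw [Matrix.blockDiagonal'_apply_ne _ _ _ hij, Matrix.blockDiagonal'_apply_ne _ _ _ hij, h1]
    simp

theorem det_sub_jordan_ne_zero {μ : ℂ} (hμ : ∀ i, μ ≠ lam i) :
    (μ • 1 - jordan lam r).det ≠ 0 := by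
  have h := congrArg Matrix.det (sub_jordan_mul_matD (r := r) (lam := lam) (μ := star μ)
    fun i h => hμ i (star_injective h))
  rw [Matrix.det_mul, Matrix.det_one] at h
  intro h0
  have h' : (star μ • 1 - (jordan lam r)ᴴ).det = 0 := by
    rw [← Matrix.conjTranspose_one, ← Matrix.conjTranspose_smul, ← Matrix.conjTranspose_sub,
      Matrix.det_conjTranspose, h0, star_zero]
  rw [h', zero_mul] at h
  exact zero_ne_one h

/-- An eigenvector of the Jordan matrix is supported on a single index, the first one of a block. -/
theorem exists_support_of_jordan_eigenvector (hinj : Function.Injective lam)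
    {w : (Σ i : Fin k, Fin (r i)) → ℂ} {μ : ℂ} (hw : w ≠ 0) (h : jordan lam r *ᵥ w = μ • w) :
    ∃ c : Σ i : Fin k, Fin (r i), (c.2 : ℕ) = 0 ∧ w c ≠ 0 ∧ ∀ d, d ≠ c → w d = 0 := by
  have hc : ∀ c, lam c.1 * w c +
      (if h : (c.2 : ℕ) + 1 < r c.1 then w ⟨c.1, ⟨c.2 + 1, h⟩⟩ else 0) = μ * w c := fun c => by
    rw [← jordan_mulVec_apply, h]; rfl
  have h1 : ∀ n : ℕ, ∀ c : Σ i : Fin k, Fin (r i), r c.1 - c.2 = n → lam c.1 ≠ μ → w c = 0 := by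
    intro n
    induction n with
    | zero => intro c hn; have := c.2.2; omega
    | succ n ih =>
      intro c hn hμ
      have e := hc c
      have : (if h : (c.2 : ℕ) + 1 < r c.1 then w ⟨c.1, ⟨c.2 + 1, h⟩⟩ else 0) = 0 :=
        dite_eq_right_iff.2 fun h => ih _ (by simp; omega) hμ
      rw [this, add_zero, ← sub_eq_zero, ← sub_mul] at e
      exact (mul_eq_zero.1 e).resolve_left (sub_ne_zero.2 hμ)
  have h2 : ∀ c, w c ≠ 0 → lam c.1 = μ ∧ (c.2 : ℕ) = 0 := by
    intro c hwc
    have hμ : lam c.1 = μ := by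
      by_contra hne
      exact hwc (h1 _ c rfl hne)
    refine ⟨hμ, ?_⟩
    by_contra h0
    obtain ⟨i, c, hci⟩ := c
    obtain ⟨c, rfl⟩ : ∃ c', c = c' + 1 := ⟨c - 1, by simp at h0; omega⟩
    have e := hc ⟨i, ⟨c, by omega⟩⟩
    simp only at hμ
    simp only [hci, dite_true, hμ, add_eq_left] at e
    exact hwc e
  obtain ⟨c, hwc⟩ := Function.ne_iff.1 hw
  refine ⟨c, (h2 c hwc).2, hwc, fun d hd => ?_⟩
  by_contra hwd
  have e1 : d.1 = c.1 := hinj ((h2 d hwd).1.trans (h2 c hwc).1.symm)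
  have e2 : (d.2 : ℕ) = c.2 := (h2 d hwd).2.trans (h2 c hwc).2.symm
  obtain ⟨i, c⟩ := c
  obtain ⟨j, d⟩ := d
  obtain rfl : j = i := e1
  exact hd (congrArg (Sigma.mk j) (Fin.ext e2))

open scoped ComplexOrder in
/-- A skew-Hermitian solution of the Sylvester equation is invertible as soon as `Y` has no zero
among its columns that start a block: `Y` vanishes on the kernel of `M`, which is therefore stable
under the Jordan matrix and would contain an eigenvector of it. -/
theorem det_ne_zero_of_sylvester {ι : Type*} [Fintype ι] (hinj : Function.Injective lam)
    {M : Matrix (Σ i : Fin k, Fin (r i)) (Σ i : Fin k, Fin (r i)) ℂ}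
    {Y : Matrix ι (Σ i : Fin k, Fin (r i)) ℂ}
    (hM : M * jordan lam r - (jordan lam r)ᴴ * M = Yᴴ * Y) (hskew : Mᴴ = -M)
    (hY : ∀ c : Σ i : Fin k, Fin (r i), (c.2 : ℕ) = 0 → (fun a => Y a c) ≠ 0) : M.det ≠ 0 := by
  intro hdet
  obtain ⟨c₀, hc₀, hMc₀⟩ := Matrix.exists_mulVec_eq_zero_iff.2 hdet
  have hker : ∀ c, M *ᵥ c = 0 → Y *ᵥ c = 0 := fun c hc => by
    have h1 : star c ᵥ* M = 0 := by
      have := Matrix.star_mulVec M c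
      rw [hc, hskew, Matrix.vecMul_neg, star_zero] at this
      exact neg_eq_zero.1 this.symm
    have h2 := congrArg (fun A => star c ⬝ᵥ A *ᵥ c) hM
    simp only [Matrix.sub_mulVec, ← Matrix.mulVec_mulVec, hc, Matrix.mulVec_zero, sub_zero] at h2
    rw [Matrix.dotProduct_mulVec, h1, zero_dotProduct, Matrix.dotProduct_mulVec,
      ← Matrix.star_mulVec] at h2
    exact dotProduct_star_self_eq_zero.1 h2.symm
  have hstab : ∀ c ∈ LinearMap.ker M.mulVecLin, (jordan lam r).mulVecLin c ∈
      LinearMap.ker M.mulVecLin := fun c hc => by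
    simp only [LinearMap.mem_ker, Matrix.mulVecLin_apply] at hc ⊢
    have h2 := congrArg (fun A => A *ᵥ c) hM
    simp only [Matrix.sub_mulVec, ← Matrix.mulVec_mulVec, hc, hker c hc, Matrix.mulVec_zero,
      sub_zero] at h2
    exact h2
  have : Nontrivial (LinearMap.ker M.mulVecLin) :=
    ⟨⟨⟨c₀, hMc₀⟩, 0, fun h => hc₀ (congrArg Subtype.val h)⟩⟩
  obtain ⟨μ, hμ⟩ := Module.End.exists_eigenvalue ((jordan lam r).mulVecLin.restrict hstab)
  obtain ⟨w, hw⟩ := hμ.exists_hasEigenvector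
  have hw1 : jordan lam r *ᵥ (w : _ → ℂ) = μ • (w : _ → ℂ) :=
    congrArg Subtype.val hw.apply_eq_smul
  obtain ⟨c, hc, hwc, hsupp⟩ := exists_support_of_jordan_eigenvector hinj
    (fun h => hw.2 (Subtype.ext h)) hw1
  refine hY c hc (funext fun a => ?_)
  have h := congrFun (hker w w.2) a
  simp only [Matrix.mulVec, dotProduct] at h
  rw [Finset.sum_eq_single c (fun d _ hd => by rw [hsupp d hd, mul_zero]) (by simp)] at h
  exact (mul_eq_zero.1 h).resolve_right hwc

end Jordan

/-! ### Regularity of the Lax matrices -/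

/-- The part `W = -σ₃ Q² / 2 - i σ₃ Q_x / 2` of the temporal Lax matrix that does not depend on the
spectral parameter, so that `V = i (λ² σ₃ + λ Q + W)`. -/
noncomputable def lowV {n : ℕ} (q : ℝ → ℝ → Fin n → ℂ) (x t : ℝ) : Matrix (Idx n) (Idx n) ℂ :=
  -((1 / 2 : ℂ) • (sigma3 n * potential (q x t) ^ 2))
    - (Complex.I / 2) • (sigma3 n * potential (deriv (fun s : ℝ => q s t) x))

theorem laxV_eq {n : ℕ} (q : ℝ → ℝ → Fin n → ℂ) (μ : ℂ) (x t : ℝ) :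
    laxV q μ x t = Complex.I • (μ ^ 2 • sigma3 n + μ • potential (q x t) + lowV q x t) := by
  rw [laxV, lowV]; congr 1; abel

theorem entryContDiffAt_potential {n : ℕ} {E : Type*} [NormedAddCommGroup E] [NormedSpace ℝ E]
    {m : WithTop ℕ∞} {w : E → Fin n → ℂ} {z : E} (hw : ContDiffAt ℝ m w z) :
    EntryContDiffAt m (fun y => potential (w y)) z := by
  have h := contDiffAt_pi.1 hw
  rintro (i | i) (j | j)
  · exact contDiffAt_const
  · exact Complex.conjCLE.contDiff.contDiffAt.comp z (h j)
  · exact h i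
  · exact contDiffAt_const

theorem hasEntryDerivAt_potential {n : ℕ} {w : ℝ → Fin n → ℂ} {w' : Fin n → ℂ} {s : ℝ}
    (hw : HasDerivAt w w' s) : HasEntryDerivAt (fun y => potential (w y)) (potential w') s := by
  have h := hasDerivAt_pi.1 hw
  rintro (i | i) (j | j)
  · exact hasDerivAt_const _ _
  · exact (h j).star
  · exact h i
  · exact hasDerivAt_const _ _

section Smooth

variable {n : ℕ} {q : ℝ → ℝ → Fin n → ℂ}

theorem hasDerivAt_fst_of_contDiffAt {x t : ℝ}
    (hq : ContDiffAt ℝ ∞ (fun z : ℝ × ℝ => q z.1 z.2) (x, t)) :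
    HasDerivAt (fun s => q s t) (deriv (fun s => q s t) x) x := by
  have : ContDiffAt ℝ ∞ (fun s => q s t) x :=
    hq.comp x (f := fun s : ℝ => (s, t)) (contDiffAt_id.prodMk contDiffAt_const)
  exact (this.differentiableAt (by simp)).hasDerivAt

theorem hasDerivAt_snd_of_contDiffAt {x t : ℝ}
    (hq : ContDiffAt ℝ ∞ (fun z : ℝ × ℝ => q z.1 z.2) (x, t)) :
    HasDerivAt (fun s => q x s) (deriv (fun s => q x s) t) t := by
  have : ContDiffAt ℝ ∞ (fun s => q x s) t :=
    hq.comp t (f := fun s : ℝ => (x, s)) (contDiffAt_const.prodMk contDiffAt_id)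
  exact (this.differentiableAt (by simp)).hasDerivAt

theorem hasDerivAt_deriv_of_contDiffAt {x t : ℝ}
    (hq : ContDiffAt ℝ ∞ (fun z : ℝ × ℝ => q z.1 z.2) (x, t)) :
    HasDerivAt (fun s => deriv (fun y => q y t) s)
      (deriv (fun s => deriv (fun y => q y t) s) x) x := by
  have : ContDiffAt ℝ ∞ (fun s => q s t) x :=
    hq.comp x (f := fun s : ℝ => (s, t)) (contDiffAt_id.prodMk contDiffAt_const)
  exact ((this.derivWithin (m := ∞) (by simp)).differentiableAt (by simp)).hasDerivAt

theorem contDiff_deriv_fst (hq : ContDiff ℝ ∞ (fun z : ℝ × ℝ => q z.1 z.2)) :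
    ContDiff ℝ ∞ fun z : ℝ × ℝ => deriv (fun s => q s z.2) z.1 := by
  have h : (fun z : ℝ × ℝ => deriv (fun s => q s z.2) z.1) =
      fun z => fderiv ℝ (fun z : ℝ × ℝ => q z.1 z.2) z (1, 0) := by
    funext z
    have h1 := (hq.differentiable (by simp) z).hasFDerivAt
    have h2 : HasDerivAt (fun s : ℝ => (s, z.2)) ((1 : ℝ), (0 : ℝ)) z.1 :=
      (hasDerivAt_id z.1).prodMk (hasDerivAt_const _ _)
    exact (h1.comp_hasDerivAt z.1 h2).deriv
  rw [h]
  exact (hq.fderiv_right (m := ∞) (by simp)).clm_apply contDiff_const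

theorem entryContDiffAt_lowV (hq : ContDiff ℝ ∞ (fun z : ℝ × ℝ => q z.1 z.2)) {m : WithTop ℕ∞}
    (hm : m ≤ ∞) (z : ℝ × ℝ) : EntryContDiffAt m (fun z : ℝ × ℝ => lowV q z.1 z.2) z := by
  have h1 := entryContDiffAt_potential ((hq.of_le hm).contDiffAt (x := z))
  have h2 := entryContDiffAt_potential (((contDiff_deriv_fst hq).of_le hm).contDiffAt (x := z))
  have h3 := EntryContDiffAt.smul (contDiffAt_const (c := (-(1 / 2) : ℂ)))
    ((EntryContDiffAt.const (sigma3 n)).mul (h1.mul h1))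
  have h4 := EntryContDiffAt.smul (contDiffAt_const (c := Complex.I / 2))
    ((EntryContDiffAt.const (sigma3 n)).mul h2)
  have h5 := h3.sub h4
  simpa only [lowV, sq, neg_smul] using h5

theorem continuous_laxU (hq : ContDiff ℝ ∞ (fun z : ℝ × ℝ => q z.1 z.2)) (a b : Idx n) :
    Continuous fun p : ℂ × ℝ × ℝ => laxU q p.1 p.2.1 p.2.2 a b := by
  refine (contDiff_iff_contDiffAt.2 fun z => ?_ : ContDiff ℝ 0 _).continuous
  have h1 : EntryContDiffAt 0 (fun p : ℂ × ℝ × ℝ => potential (q p.2.1 p.2.2)) z :=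
    (entryContDiffAt_potential ((hq.of_le (by simp)).contDiffAt (x := z.2))).comp contDiffAt_snd
  exact EntryContDiffAt.smul contDiffAt_const
    ((EntryContDiffAt.smul contDiffAt_fst (EntryContDiffAt.const (sigma3 n))).add h1) a b

theorem continuous_laxV (hq : ContDiff ℝ ∞ (fun z : ℝ × ℝ => q z.1 z.2)) (a b : Idx n) :
    Continuous fun p : ℂ × ℝ × ℝ => laxV q p.1 p.2.1 p.2.2 a b := by
  refine (contDiff_iff_contDiffAt.2 fun z => ?_ : ContDiff ℝ 0 _).continuous
  have h1 : EntryContDiffAt 0 (fun p : ℂ × ℝ × ℝ => potential (q p.2.1 p.2.2)) z :=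
    (entryContDiffAt_potential ((hq.of_le (by simp)).contDiffAt (x := z.2))).comp contDiffAt_snd
  have h2 : EntryContDiffAt 0 (fun p : ℂ × ℝ × ℝ => lowV q p.2.1 p.2.2) z :=
    (entryContDiffAt_lowV hq (by simp) z.2).comp contDiffAt_snd
  simp only [laxV_eq]
  exact EntryContDiffAt.smul contDiffAt_const
    (((EntryContDiffAt.smul (contDiffAt_fst.pow 2) (EntryContDiffAt.const (sigma3 n))).add
      (EntryContDiffAt.smul contDiffAt_fst h1)).add h2) a b

end Smooth

/-! ### The system satisfied by the Taylor coefficients -/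

section Phi

variable {n k : ℕ} {q : ℝ → ℝ → Fin n → ℂ}
  {Φ : ℂ → ℝ → ℝ → Matrix (Idx n) (Idx n) ℂ} {v : ℂ → Idx n → ℂ} {lam : Fin k → ℂ}

/-- The `j`-th Taylor coefficient of `λ Φ(λ) v(λ)` at `lam i`, in terms of those of
`Φ(λ) v(λ)`. -/
noncomputable def phi₁ (Φ : ℂ → ℝ → ℝ → Matrix (Idx n) (Idx n) ℂ) (v : ℂ → Idx n → ℂ)
    (lam : Fin k → ℂ) (i : Fin k) (j : ℕ) (x t : ℝ) : Idx n → ℂ :=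
  lam i • phi Φ v lam i j x t + if 0 < j then phi Φ v lam i (j - 1) x t else 0

/-- The `j`-th Taylor coefficient of `λ² Φ(λ) v(λ)` at `lam i`. -/
noncomputable def phi₂ (Φ : ℂ → ℝ → ℝ → Matrix (Idx n) (Idx n) ℂ) (v : ℂ → Idx n → ℂ)
    (lam : Fin k → ℂ) (i : Fin k) (j : ℕ) (x t : ℝ) : Idx n → ℂ :=
  lam i • phi₁ Φ v lam i j x t + if 0 < j then phi₁ Φ v lam i (j - 1) x t else 0

theorem hasDerivAt_mulVec_of_entry {ι : Type*} [Fintype ι] {A : ℝ → Matrix ι ι ℂ}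
    {A' : Matrix ι ι ℂ} {s : ℝ} (h : HasEntryDerivAt A A' s) (w : ι → ℂ) :
    HasDerivAt (fun y => A y *ᵥ w) (A' *ᵥ w) s :=
  hasDerivAt_pi.2 fun a => by
    simp only [Matrix.mulVec, dotProduct]
    exact HasDerivAt.fun_sum fun b _ => (h a b).mul_const _

/-- The Lax pair expanded at `lam i`: the system satisfied by the Taylor coefficients, and their
local boundedness in `(x, t)`. -/
theorem phi_system (hq : ContDiff ℝ ∞ (fun z : ℝ × ℝ => q z.1 z.2))
    (hΦ : ∀ x t a b, Differentiable ℂ (fun μ => Φ μ x t a b))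
    (hLax : ∀ μ x t, SolvesLaxAt q μ (Φ μ) x t) (hv : ∀ i, AnalyticAt ℂ v (lam i))
    (i : Fin k) (j : ℕ) (a : Idx n) (x t : ℝ) :
    HasDerivAt (fun s => phi Φ v lam i j s t a) ((Complex.I • (sigma3 n *ᵥ phi₁ Φ v lam i j x t +
      potential (q x t) *ᵥ phi Φ v lam i j x t)) a) x ∧
    HasDerivAt (fun s => phi Φ v lam i j x s a) ((Complex.I • (sigma3 n *ᵥ phi₂ Φ v lam i j x t +
      potential (q x t) *ᵥ phi₁ Φ v lam i j x t + lowV q x t *ᵥ phi Φ v lam i j x t)) a) t ∧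
    (fun p : ℝ × ℝ => phi Φ v lam i j p.1 p.2 a) =O[𝓝 (x, t)] fun _ => (1 : ℝ) := by
  obtain ⟨R, hR, hvR⟩ := Metric.nhds_basis_closedBall.eventually_iff.1 (hv i).eventually_analyticAt
  have hh : ∀ x t, ∀ μ ∈ closedBall (lam i) R, ∀ a,
      AnalyticAt ℂ (fun μ => (Φ μ x t *ᵥ v μ) a) μ := fun x t μ hμ a => by
    simp only [Matrix.mulVec_eq_sum, Finset.sum_apply, Pi.smul_apply,
      MulOpposite.smul_eq_mul_unop, MulOpposite.unop_op, Matrix.transpose_apply]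
    exact Finset.analyticAt_fun_sum _ fun b _ =>
      ((hΦ x t a b).analyticAt μ).mul (analyticAt_pi_iff.1 (hvR hμ) b)
  have hc : ∀ a, AnalyticAt ℂ (fun μ => (Φ μ x t *ᵥ v μ) a) (lam i) :=
    hh x t _ (mem_closedBall_self hR.le)
  have hc₁ : ∀ a, AnalyticAt ℂ (fun μ => (μ • (Φ μ x t *ᵥ v μ)) a) (lam i) := fun a =>
    analyticAt_id.mul (hc a)
  have hc₂ : ∀ a, AnalyticAt ℂ (fun μ => (μ • μ • (Φ μ x t *ᵥ v μ)) a) (lam i) := fun a =>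
    analyticAt_id.mul (hc₁ a)
  have hmul : ∀ (A : Matrix (Idx n) (Idx n) ℂ) (w : ℂ → Idx n → ℂ),
      (∀ a, AnalyticAt ℂ (fun μ => w μ a) (lam i)) →
      ∀ a, AnalyticAt ℂ (fun μ => (A *ᵥ w μ) a) (lam i) := fun A w hw a => by
    simp only [Matrix.mulVec_eq_sum, Finset.sum_apply, Pi.smul_apply,
      MulOpposite.smul_eq_mul_unop, MulOpposite.unop_op, Matrix.transpose_apply]
    exact Finset.analyticAt_fun_sum _ fun b _ => analyticAt_const.mul (hw b)
  have e₁ : ∀ j, taylorCoeff (lam i) j (fun μ => μ • (Φ μ x t *ᵥ v μ)) = phi₁ Φ v lam i j x t :=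
    fun j => taylorCoeff_smul hc j
  have e₂ : ∀ j, taylorCoeff (lam i) j (fun μ => μ • μ • (Φ μ x t *ᵥ v μ)) =
      phi₂ Φ v lam i j x t := fun j => by
    rw [taylorCoeff_smul hc₁ j, e₁, e₁]; rfl
  have e₀ : taylorCoeff (lam i) j (fun μ => Φ μ x t *ᵥ v μ) = phi Φ v lam i j x t := rfl
  have key := taylorCoeff_linear_system (A := laxU q) (B := laxV q)
    (h := fun μ x t => Φ μ x t *ᵥ v μ) hR (continuous_laxU hq) (continuous_laxV hq)
    (fun x t a b => by simp only [laxU, Matrix.smul_apply, Matrix.add_apply]; fun_prop)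
    (fun x t a b => by simp only [laxV_eq, Matrix.smul_apply, Matrix.add_apply]; fun_prop)
    (fun x t a μ hμ => (hh x t μ hμ a).differentiableAt.differentiableWithinAt)
    (fun μ _ x t => by
      rw [Matrix.mulVec_mulVec]
      exact hasDerivAt_mulVec_of_entry (hLax μ x t).1 _)
    (fun μ _ x t => by
      rw [Matrix.mulVec_mulVec]
      exact hasDerivAt_mulVec_of_entry (A := fun s => Φ μ x s) (hLax μ x t).2 _) j a x t
  have eU : taylorCoeff (lam i) j (fun μ => laxU q μ x t *ᵥ (Φ μ x t *ᵥ v μ)) =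
      Complex.I • (sigma3 n *ᵥ phi₁ Φ v lam i j x t +
        potential (q x t) *ᵥ phi Φ v lam i j x t) := by
    have : (fun μ => laxU q μ x t *ᵥ (Φ μ x t *ᵥ v μ)) = fun μ =>
        (Complex.I • sigma3 n) *ᵥ (μ • (Φ μ x t *ᵥ v μ)) +
          (Complex.I • potential (q x t)) *ᵥ (Φ μ x t *ᵥ v μ) := by
      funext μ
      simp only [laxU, Matrix.smul_mulVec, Matrix.add_mulVec, Matrix.mulVec_smul, smul_add,
        smul_comm Complex.I μ]
    rw [this, taylorCoeff_add (hmul _ _ hc₁) (hmul _ _ hc), taylorCoeff_mulVec hc₁,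
      taylorCoeff_mulVec hc, e₁, e₀]
    simp only [Matrix.smul_mulVec, smul_add]
  have eV : taylorCoeff (lam i) j (fun μ => laxV q μ x t *ᵥ (Φ μ x t *ᵥ v μ)) =
      Complex.I • (sigma3 n *ᵥ phi₂ Φ v lam i j x t +
        potential (q x t) *ᵥ phi₁ Φ v lam i j x t + lowV q x t *ᵥ phi Φ v lam i j x t) := by
    have : (fun μ => laxV q μ x t *ᵥ (Φ μ x t *ᵥ v μ)) = fun μ =>
        ((Complex.I • sigma3 n) *ᵥ (μ • μ • (Φ μ x t *ᵥ v μ)) +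
          (Complex.I • potential (q x t)) *ᵥ (μ • (Φ μ x t *ᵥ v μ))) +
          (Complex.I • lowV q x t) *ᵥ (Φ μ x t *ᵥ v μ) := by
      funext μ
      simp only [laxV_eq, Matrix.smul_mulVec, Matrix.add_mulVec, Matrix.mulVec_smul, smul_add,
        sq, mul_smul, smul_comm Complex.I μ]
    rw [this, taylorCoeff_add (g := fun μ => (Complex.I • sigma3 n) *ᵥ (μ • μ • (Φ μ x t *ᵥ v μ)) +
        (Complex.I • potential (q x t)) *ᵥ (μ • (Φ μ x t *ᵥ v μ)))
        (fun a => (hmul _ _ hc₂ a).add (hmul _ _ hc₁ a)) (hmul _ _ hc),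
      taylorCoeff_add (hmul _ _ hc₂) (hmul _ _ hc₁), taylorCoeff_mulVec hc₂,
      taylorCoeff_mulVec hc₁, taylorCoeff_mulVec hc, e₂, e₁, e₀]
    simp only [Matrix.smul_mulVec, smul_add]
  rw [← eU, ← eV]
  exact key

theorem contDiffAt_mulVec {E : Type*} [NormedAddCommGroup E] [NormedSpace ℝ E] {ι : Type*}
    [Fintype ι] {m : WithTop ℕ∞} {A : E → Matrix ι ι ℂ} {w : E → ι → ℂ} {z : E}
    (hA : EntryContDiffAt m A z) (hw : ContDiffAt ℝ m w z) :
    ContDiffAt ℝ m (fun y => A y *ᵥ w y) z := by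
  refine contDiffAt_pi.2 fun a => ?_
  simp only [Matrix.mulVec, dotProduct]
  exact ContDiffAt.sum fun b _ => (hA a b).mul (contDiffAt_pi.1 hw b)

theorem isBigO_one_mulVec {ι : Type*} [Fintype ι] {A : ℝ × ℝ → Matrix ι ι ℂ} {w : ℝ × ℝ → ι → ℂ}
    {z : ℝ × ℝ} (hA : EntryContDiffAt 0 A z)
    (hw : ∀ a, (fun p => w p a) =O[𝓝 z] fun _ => (1 : ℝ)) (a : ι) :
    (fun p => (A p *ᵥ w p) a) =O[𝓝 z] fun _ => (1 : ℝ) := by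
  simp only [Matrix.mulVec, dotProduct]
  refine Asymptotics.IsBigO.fun_sum fun b _ => ?_
  simpa using ((hA a b).continuousAt.tendsto.isBigO_one ℝ).mul (hw b)

/-- Smoothness in `(x, t)`: local boundedness of all coefficients makes the partial derivatives
locally bounded, which gives continuity, and the system then raises the order step by step. -/
theorem contDiff_phi (hq : ContDiff ℝ ∞ (fun z : ℝ × ℝ => q z.1 z.2))
    (hΦ : ∀ x t a b, Differentiable ℂ (fun μ => Φ μ x t a b))
    (hLax : ∀ μ x t, SolvesLaxAt q μ (Φ μ) x t) (hv : ∀ i, AnalyticAt ℂ v (lam i))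
    (i : Fin k) (j : ℕ) (a : Idx n) :
    ContDiff ℝ ∞ fun p : ℝ × ℝ => phi Φ v lam i j p.1 p.2 a := by
  have hsys := phi_system hq hΦ hLax hv i
  have hQ : ∀ m : ℕ, ∀ z, EntryContDiffAt m (fun p : ℝ × ℝ => potential (q p.1 p.2)) z :=
    fun m z => entryContDiffAt_potential (hq.of_le (by exact_mod_cast le_top)).contDiffAt
  have hW : ∀ m : ℕ, ∀ z, EntryContDiffAt m (fun p : ℝ × ℝ => lowV q p.1 p.2) z :=
    fun m z => entryContDiffAt_lowV hq (by exact_mod_cast le_top) z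
  have hσ : ∀ m : ℕ, ∀ z, EntryContDiffAt m (fun _ : ℝ × ℝ => sigma3 n) z :=
    fun m z => EntryContDiffAt.const _
  refine contDiff_infty_of_partial (ι := ℕ × Idx n)
    (F := fun c x t => phi Φ v lam i c.1 x t c.2)
    (fun c x t => (hsys c.1 c.2 x t).1) (fun c x t => (hsys c.1 c.2 x t).2.1) ?_ ?_ (j, a)
  · refine fun c => continuous_iff_continuousAt.2 fun z => ?_
    have b₀ : ∀ j a, (fun p : ℝ × ℝ => phi Φ v lam i j p.1 p.2 a) =O[𝓝 z] fun _ => (1 : ℝ) :=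
      fun j a => (hsys j a z.1 z.2).2.2
    have b₁ : ∀ j a, (fun p : ℝ × ℝ => phi₁ Φ v lam i j p.1 p.2 a) =O[𝓝 z] fun _ => (1 : ℝ) :=
      fun j a => by
        refine ((b₀ j a).const_mul_left (lam i)).add ?_
        split_ifs
        · exact b₀ _ a
        · exact Asymptotics.isBigO_zero _ _
    have b₂ : ∀ j a, (fun p : ℝ × ℝ => phi₂ Φ v lam i j p.1 p.2 a) =O[𝓝 z] fun _ => (1 : ℝ) :=
      fun j a => by
        refine ((b₁ j a).const_mul_left (lam i)).add ?_
        split_ifs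
        · exact b₁ _ a
        · exact Asymptotics.isBigO_zero _ _
    exact continuousAt_of_isBigO_partial (fun x t => (hsys c.1 c.2 x t).1)
      (fun x t => (hsys c.1 c.2 x t).2.1)
      (((isBigO_one_mulVec (hσ 0 z) (b₁ c.1) c.2).add
        (isBigO_one_mulVec (hQ 0 z) (b₀ c.1) c.2)).const_mul_left _)
      ((((isBigO_one_mulVec (hσ 0 z) (b₂ c.1) c.2).add
        (isBigO_one_mulVec (hQ 0 z) (b₁ c.1) c.2)).add
        (isBigO_one_mulVec (hW 0 z) (b₀ c.1) c.2)).const_mul_left _)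
  · intro m hm c
    have c₀ : ∀ j z, ContDiffAt ℝ m (fun p : ℝ × ℝ => phi Φ v lam i j p.1 p.2) z := fun j z =>
      contDiffAt_pi.2 fun a => (hm (j, a)).contDiffAt
    have c₁ : ∀ j z, ContDiffAt ℝ m (fun p : ℝ × ℝ => phi₁ Φ v lam i j p.1 p.2) z := fun j z => by
      refine ((c₀ j z).const_smul (lam i)).add ?_
      split_ifs
      · exact c₀ _ z
      · exact contDiffAt_const
    have c₂ : ∀ j z, ContDiffAt ℝ m (fun p : ℝ × ℝ => phi₂ Φ v lam i j p.1 p.2) z := fun j z => by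
      refine ((c₁ j z).const_smul (lam i)).add ?_
      split_ifs
      · exact c₁ _ z
      · exact contDiffAt_const
    refine ⟨contDiff_iff_contDiffAt.2 fun z => ?_, contDiff_iff_contDiffAt.2 fun z => ?_⟩
    · exact contDiffAt_pi.1 (((contDiffAt_mulVec (hσ m z) (c₁ c.1 z)).add
        (contDiffAt_mulVec (hQ m z) (c₀ c.1 z))).const_smul Complex.I) c.2
    · exact contDiffAt_pi.1 ((((contDiffAt_mulVec (hσ m z) (c₂ c.1 z)).add
        (contDiffAt_mulVec (hQ m z) (c₁ c.1 z))).add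
        (contDiffAt_mulVec (hW m z) (c₀ c.1 z))).const_smul Complex.I) c.2

/-- The value `Φ(λ_i) v(λ_i)` solves a linear system, so it vanishes nowhere if it does not vanish
at the origin. -/
theorem phi_zero_ne_zero (hq : ContDiff ℝ ∞ (fun z : ℝ × ℝ => q z.1 z.2))
    (hLax : ∀ μ x t, SolvesLaxAt q μ (Φ μ) x t) {i : Fin k}
    (h0 : Φ (lam i) 0 0 *ᵥ v (lam i) ≠ 0) (x t : ℝ) : phi Φ v lam i 0 x t ≠ 0 := by
  intro h
  obtain ⟨K, hK⟩ := exists_norm_le_mul_of_linear_system (S := {lam i}) isCompact_singleton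
    (h := fun μ x t => Φ μ x t *ᵥ v μ) (continuous_laxU hq) (continuous_laxV hq)
    (fun μ _ x t => by
      rw [Matrix.mulVec_mulVec]
      exact hasDerivAt_mulVec_of_entry (hLax μ x t).1 _)
    (fun μ _ x t => by
      rw [Matrix.mulVec_mulVec]
      exact hasDerivAt_mulVec_of_entry (A := fun s => Φ μ x s) (hLax μ x t).2 _)
    x t (max |x| |t|)
  have h1 := hK (lam i) rfl 0 (by simp) 0 (by simp)
  have h2 : Φ (lam i) x t *ᵥ v (lam i) = 0 := (taylorCoeff_zero _ _).symm.trans h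
  rw [h2, norm_zero, zero_mul] at h1
  exact h0 (norm_le_zero_iff.1 h1)

end Phi

/-! ### Symmetries of the Lax matrices -/

theorem sigma3_mul_self (n : ℕ) : sigma3 n * sigma3 n = 1 := by
  simp [sigma3, Matrix.fromBlocks_multiply, ← Matrix.fromBlocks_one]

theorem sigma3_conjTranspose (n : ℕ) : (sigma3 n)ᴴ = sigma3 n := by
  simp [sigma3, Matrix.fromBlocks_conjTranspose]

theorem sigma3_mul_potential {n : ℕ} (w : Fin n → ℂ) :
    sigma3 n * potential w = -(potential w * sigma3 n) := by
  simp [sigma3, potential, Matrix.fromBlocks_multiply, Matrix.fromBlocks_neg]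

theorem potential_conjTranspose {n : ℕ} (w : Fin n → ℂ) : (potential w)ᴴ = potential w := by
  simp only [potential, Matrix.fromBlocks_conjTranspose, Matrix.conjTranspose_zero,
    Matrix.conjTranspose_replicateCol, Matrix.conjTranspose_replicateRow, star_star]

theorem lowV_conjTranspose {n : ℕ} (q : ℝ → ℝ → Fin n → ℂ) (x t : ℝ) :
    (lowV q x t)ᴴ = lowV q x t := by
  have h := sigma3_mul_potential (q x t)
  have h' := sigma3_mul_potential (deriv (fun s : ℝ => q s t) x)
  simp only [lowV, sq, Matrix.conjTranspose_sub, Matrix.conjTranspose_neg,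
    Matrix.conjTranspose_smul, Matrix.conjTranspose_mul, potential_conjTranspose,
    sigma3_conjTranspose]
  have e1 : potential (q x t) * potential (q x t) * sigma3 n =
      sigma3 n * (potential (q x t) * potential (q x t)) := by
    rw [← Matrix.mul_assoc (sigma3 n), h, Matrix.neg_mul, Matrix.mul_assoc _ (sigma3 n), h,
      Matrix.mul_neg, neg_neg, Matrix.mul_assoc]
  rw [e1, h', smul_neg, ← neg_smul]
  have e2 : star (1 / 2 : ℂ) = 1 / 2 := by simp
  have e3 : star (Complex.I / 2 : ℂ) = -(Complex.I / 2) := by simp [neg_div]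
  rw [e2, e3]
  module

/-! ### The algebra of the dressing -/

section Algebra

variable {m N : Type*} [Fintype m] [Fintype N] [DecidableEq N]
  {S Q W : Matrix m m ℂ} {Y : Matrix m N ℂ} {M P J Z : Matrix N N ℂ}

/-- The Sylvester equation multiplied by `P = M⁻¹` on both sides; stated with a right factor `X` so
as to rewrite in right-associated products. -/
theorem mul_inverse_sylvester (hPM : P * M = 1) (hMP : M * P = 1)
    (hM : M * J - Jᴴ * M = Yᴴ * Y) (X : Matrix N m ℂ) :
    J * (P * X) = P * (Jᴴ * X) + P * (Yᴴ * (Y * (P * X))) := by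
  have : J * P = P * Jᴴ + P * (Yᴴ * Y) * P := by
    rw [← hM, Matrix.mul_sub, Matrix.sub_mul, ← Matrix.mul_assoc P M, hPM, Matrix.one_mul,
      Matrix.mul_assoc P, Matrix.mul_assoc Jᴴ, hMP, Matrix.mul_one]
    abel
  simp only [← Matrix.mul_assoc, this, Matrix.add_mul]

/-- The derivative in `x` of `Y P Z Y†`, for constant `Z`, given by the product rule, in closed
form. -/
theorem dress_algebra_x (hS : Sᴴ = S) (hQ : Qᴴ = Q) (hPM : P * M = 1) (hMP : M * P = 1)
    (hM : M * J - Jᴴ * M = Yᴴ * Y) (hZ : Jᴴ * Z = Z * Jᴴ) :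
    ((Complex.I • (S * (Y * J) + Q * Y)) * P +
        Y * -(P * (Complex.I • (Yᴴ * S * Y)) * P)) * Z * Yᴴ +
      Y * P * Z * (Complex.I • (S * (Y * J) + Q * Y))ᴴ =
    Complex.I • (S * (Y * P * (Z * Jᴴ) * Yᴴ) - Y * P * (Z * Jᴴ) * Yᴴ * S +
      (Q + S * (Y * P * (1 : Matrix N N ℂ) * Yᴴ) - Y * P * (1 : Matrix N N ℂ) * Yᴴ * S) *
        (Y * P * Z * Yᴴ) -
      Y * P * Z * Yᴴ * Q) := by
  have hJ := mul_inverse_sylvester hPM hMP hM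
  have hZ' : ∀ X : Matrix N m ℂ, Jᴴ * (Z * X) = Z * (Jᴴ * X) := fun X => by
    rw [← Matrix.mul_assoc, hZ, Matrix.mul_assoc]
  simp only [Matrix.conjTranspose_smul, Matrix.conjTranspose_add, Matrix.conjTranspose_mul, hS, hQ,
    Matrix.mul_add, Matrix.add_mul, Matrix.sub_mul, Matrix.mul_neg, Matrix.neg_mul,
    Matrix.smul_mul, Matrix.mul_smul, Matrix.mul_assoc, hJ, hZ', Matrix.one_mul,
    Complex.star_def, Complex.conj_I, smul_add, smul_sub]
  module

/-- The derivative in `t` of `Y P Z Y†`, for constant `Z`, given by the product rule, in closed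
form. -/
theorem dress_algebra_t (hS : Sᴴ = S) (hQ : Qᴴ = Q) (hW : Wᴴ = W) (hPM : P * M = 1)
    (hMP : M * P = 1) (hM : M * J - Jᴴ * M = Yᴴ * Y) (hZ : Jᴴ * Z = Z * Jᴴ) :
    ((Complex.I • (S * (Y * J * J) + Q * (Y * J) + W * Y)) * P +
        Y * -(P * (Complex.I • (Yᴴ * S * Y * J + Jᴴ * (Yᴴ * S * Y) + Yᴴ * Q * Y)) * P)) * Z * Yᴴ +
      Y * P * Z * (Complex.I • (S * (Y * J * J) + Q * (Y * J) + W * Y))ᴴ =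
    Complex.I • (S * (Y * P * (Z * Jᴴ * Jᴴ) * Yᴴ) - Y * P * (Z * Jᴴ * Jᴴ) * Yᴴ * S +
      (Q + S * (Y * P * (1 : Matrix N N ℂ) * Yᴴ) - Y * P * (1 : Matrix N N ℂ) * Yᴴ * S) *
        (Y * P * (Z * Jᴴ) * Yᴴ) -
      Y * P * (Z * Jᴴ) * Yᴴ * Q +
      (W + (S * (Y * P * Jᴴ * Yᴴ) - Y * P * Jᴴ * Yᴴ * S +
        (Q + S * (Y * P * (1 : Matrix N N ℂ) * Yᴴ) - Y * P * (1 : Matrix N N ℂ) * Yᴴ * S) *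
          (Y * P * (1 : Matrix N N ℂ) * Yᴴ) -
        Y * P * (1 : Matrix N N ℂ) * Yᴴ * Q)) * (Y * P * Z * Yᴴ) -
      Y * P * Z * Yᴴ * W) := by
  have hJ := mul_inverse_sylvester hPM hMP hM
  have hZ' : ∀ X : Matrix N m ℂ, Jᴴ * (Z * X) = Z * (Jᴴ * X) := fun X => by
    rw [← Matrix.mul_assoc, hZ, Matrix.mul_assoc]
  simp only [Matrix.conjTranspose_smul, Matrix.conjTranspose_add, Matrix.conjTranspose_mul, hS, hQ,
    hW, Matrix.mul_add, Matrix.add_mul, Matrix.sub_mul, Matrix.mul_neg,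
    Matrix.neg_mul, Matrix.smul_mul, Matrix.mul_smul, Matrix.mul_assoc, hJ, hZ', Matrix.one_mul,
    Complex.star_def, Complex.conj_I, smul_add, smul_sub]
  module

end Algebra

/-! ### Derivatives of the dressing matrices -/

section Dressing

variable {n k : ℕ} {q : ℝ → ℝ → Fin n → ℂ}
  {Φ : ℂ → ℝ → ℝ → Matrix (Idx n) (Idx n) ℂ} {v : ℂ → Idx n → ℂ} {lam : Fin k → ℂ}
  {r : Fin k → ℕ}

theorem matY_mul_jordan_apply (x t : ℝ) (a : Idx n) (c : Σ i : Fin k, Fin (r i)) :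
    (matY Φ v lam r x t * jordan lam r) a c = phi₁ Φ v lam c.1 c.2 x t a := by
  rw [mul_jordan_apply, phi₁, Pi.add_apply, Pi.smul_apply, smul_eq_mul]
  congr 1
  split_ifs <;> rfl

theorem matY_mul_jordan_mul_jordan_apply (x t : ℝ) (a : Idx n) (c : Σ i : Fin k, Fin (r i)) :
    (matY Φ v lam r x t * jordan lam r * jordan lam r) a c = phi₂ Φ v lam c.1 c.2 x t a := by
  rw [mul_jordan_apply, matY_mul_jordan_apply, phi₂, Pi.add_apply, Pi.smul_apply, smul_eq_mul]
  congr 1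
  split_ifs
  · rw [matY_mul_jordan_apply]; rfl
  · rfl

theorem sylvester_matM (hlam : ∀ i j, lam i ≠ star (lam j)) (x t : ℝ) :
    matM Φ v lam r x t * jordan lam r - (jordan lam r)ᴴ * matM Φ v lam r x t =
      (matY Φ v lam r x t)ᴴ * matY Φ v lam r x t := by
  ext c d
  have h := binomial_double_sum_recursion (sub_ne_zero.2 (hlam d.1 c.1))
    (fun s l => star (phi Φ v lam c.1 s x t) ⬝ᵥ phi Φ v lam d.1 l x t) _ (fun _ _ => rfl) c.2 d.2
  rw [Matrix.sub_apply, mul_jordan_apply, jordan_conjTranspose_mul_apply]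
  refine Eq.trans ?_ h
  simp only [matM, Matrix.of_apply, prevIdx]
  ring

/-- `M` is skew-Hermitian: `-M†` solves the same Sylvester equation as `M`. -/
theorem matM_conjTranspose (hlam : ∀ i j, lam i ≠ star (lam j)) (x t : ℝ) :
    (matM Φ v lam r x t)ᴴ = -matM Φ v lam r x t := by
  have h := sylvester_matM (Φ := Φ) (v := v) (r := r) hlam x t
  refine eq_of_sylvester hlam ?_
  have h' := congrArg Matrix.conjTranspose h
  simp only [Matrix.conjTranspose_sub, Matrix.conjTranspose_mul,
    Matrix.conjTranspose_conjTranspose] at h'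
  rw [Matrix.neg_mul, Matrix.mul_neg, ← neg_sub', ← h'.trans h.symm]
  abel

variable (hq : ContDiff ℝ ∞ (fun z : ℝ × ℝ => q z.1 z.2))
  (hΦ : ∀ x t a b, Differentiable ℂ (fun μ => Φ μ x t a b))
  (hLax : ∀ μ x t, SolvesLaxAt q μ (Φ μ) x t) (hv : ∀ i, AnalyticAt ℂ v (lam i))
include hq hΦ hLax hv

theorem entryContDiffAt_matY (z : ℝ × ℝ) :
    EntryContDiffAt ∞ (fun p : ℝ × ℝ => matY Φ v lam r p.1 p.2) z := fun a c =>
  (contDiff_phi hq hΦ hLax hv c.1 c.2 a).contDiffAt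

theorem entryContDiffAt_matM (z : ℝ × ℝ) :
    EntryContDiffAt ∞ (fun p : ℝ × ℝ => matM Φ v lam r p.1 p.2) z := fun c d => by
  simp only [matM, Matrix.of_apply, dotProduct]
  refine ContDiffAt.sum fun p _ => ContDiffAt.sum fun m _ => contDiffAt_const.mul ?_
  exact ContDiffAt.sum fun a _ => (Complex.conjCLE.contDiff.contDiffAt.comp z
    (contDiff_phi hq hΦ hLax hv c.1 _ a).contDiffAt).mul
      (contDiff_phi hq hΦ hLax hv d.1 _ a).contDiffAt

theorem hasEntryDerivAt_matY_fst (x t : ℝ) : HasEntryDerivAt (fun s => matY Φ v lam r s t)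
    (Complex.I • (sigma3 n * (matY Φ v lam r x t * jordan lam r) +
      potential (q x t) * matY Φ v lam r x t)) x := fun a c => by
  have h := (phi_system hq hΦ hLax hv c.1 c.2 a x t).1
  simp only [Matrix.smul_apply, Matrix.add_apply, Matrix.mul_apply (M := sigma3 n),
    Matrix.mul_apply (M := potential (q x t)), matY_mul_jordan_apply]
  exact h

theorem hasEntryDerivAt_matY_snd (x t : ℝ) : HasEntryDerivAt (fun s => matY Φ v lam r x s)
    (Complex.I • (sigma3 n * (matY Φ v lam r x t * jordan lam r * jordan lam r) +
      potential (q x t) * (matY Φ v lam r x t * jordan lam r) +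
      lowV q x t * matY Φ v lam r x t)) t := fun a c => by
  have h := (phi_system hq hΦ hLax hv c.1 c.2 a x t).2.1
  simp only [Matrix.smul_apply, Matrix.add_apply, Matrix.mul_apply (M := sigma3 n),
    Matrix.mul_apply (M := potential (q x t)), Matrix.mul_apply (M := lowV q x t),
    matY_mul_jordan_apply, matY_mul_jordan_mul_jordan_apply]
  exact h

theorem entryContDiffAt_matM_fst (x t : ℝ) :
    EntryContDiffAt ∞ (fun s => matM Φ v lam r s t) x :=
  (entryContDiffAt_matM hq hΦ hLax hv (x, t)).comp (g := fun s : ℝ => (s, t))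
    (contDiffAt_id.prodMk contDiffAt_const)

theorem entryContDiffAt_matM_snd (x t : ℝ) :
    EntryContDiffAt ∞ (fun s => matM Φ v lam r x s) t :=
  (entryContDiffAt_matM hq hΦ hLax hv (x, t)).comp (g := fun s : ℝ => (x, s))
    (contDiffAt_const.prodMk contDiffAt_id)

/-- `M_x = i Y† σ₃ Y`: both sides solve the differentiated Sylvester equation. -/
theorem hasEntryDerivAt_matM_fst (hlam : ∀ i j, lam i ≠ star (lam j)) (x t : ℝ) :
    HasEntryDerivAt (fun s => matM Φ v lam r s t)
      (Complex.I • ((matY Φ v lam r x t)ᴴ * sigma3 n * matY Φ v lam r x t)) x := by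
  have hM := (entryContDiffAt_matM_fst (r := r) hq hΦ hLax hv x t).hasEntryDerivAt (by simp)
  have hY := hasEntryDerivAt_matY_fst (r := r) hq hΦ hLax hv x t
  have h₁ := (hM.mul_const (jordan lam r)).sub (hM.const_mul (jordan lam r)ᴴ)
  have h₂ := hY.conjTranspose.mul hY
  simp only [← sylvester_matM hlam] at h₂
  have h₃ := h₁.unique h₂
  convert hM using 1
  refine eq_of_sylvester hlam (Eq.trans ?_ h₃.symm)
  simp only [Matrix.conjTranspose_smul, Matrix.conjTranspose_add, Matrix.conjTranspose_mul,
    sigma3_conjTranspose, potential_conjTranspose, Matrix.mul_add, Matrix.add_mul,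
    Matrix.smul_mul, Matrix.mul_smul, Matrix.mul_assoc, Complex.star_def, Complex.conj_I, smul_add]
  module

/-- `M_t = i (Y† σ₃ Y Λ + Λ† Y† σ₃ Y + Y† Q Y)`: both sides solve the differentiated Sylvester
equation. -/
theorem hasEntryDerivAt_matM_snd (hlam : ∀ i j, lam i ≠ star (lam j)) (x t : ℝ) :
    HasEntryDerivAt (fun s => matM Φ v lam r x s)
      (Complex.I • ((matY Φ v lam r x t)ᴴ * sigma3 n * matY Φ v lam r x t * jordan lam r +
        (jordan lam r)ᴴ * ((matY Φ v lam r x t)ᴴ * sigma3 n * matY Φ v lam r x t) +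
        (matY Φ v lam r x t)ᴴ * potential (q x t) * matY Φ v lam r x t)) t := by
  have hM := (entryContDiffAt_matM_snd (r := r) hq hΦ hLax hv x t).hasEntryDerivAt (by simp)
  have hY := hasEntryDerivAt_matY_snd (r := r) hq hΦ hLax hv x t
  have h₁ := (hM.mul_const (jordan lam r)).sub (hM.const_mul (jordan lam r)ᴴ)
  have h₂ := hY.conjTranspose.mul hY
  simp only [← sylvester_matM hlam] at h₂
  have h₃ := h₁.unique h₂
  convert hM using 1
  refine eq_of_sylvester hlam (Eq.trans ?_ h₃.symm)
  simp only [Matrix.conjTranspose_smul, Matrix.conjTranspose_add, Matrix.conjTranspose_mul,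
    sigma3_conjTranspose, potential_conjTranspose, lowV_conjTranspose, Matrix.mul_add,
    Matrix.add_mul, Matrix.smul_mul, Matrix.mul_smul, Matrix.mul_assoc, Complex.star_def,
    Complex.conj_I, smul_add]
  module

end Dressing

/-! ### The dressed potential -/

section DressedAlgebra

variable {m : Type*} [Fintype m] [DecidableEq m] {S Q Q' B B₁ B₂ C Qx Qx' W W' : Matrix m m ℂ}

/-- Replacing `Q` by `Q' = Q + [σ₃, B]` changes `W = -σ₃ Q² / 2 - i σ₃ Q_x / 2` by
`C = [σ₃, B₁] + Q' B - B Q`. The off-diagonal part of `C` is accounted for by the derivative,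
its diagonal part by `σ₃ C + C σ₃ = Q² - Q'²`. -/
theorem lowV_algebra (hS : S * S = 1) (hQ : S * Q = -(Q * S)) (hQ' : S * Q' = -(Q' * S))
    (hQQ' : Q' = Q + S * B - B * S) (hC : C = S * B₁ - B₁ * S + Q' * B - B * Q)
    (hx : Qx' = Qx + S * (Complex.I • C) - (Complex.I • C) * S) :
    -((1 / 2 : ℂ) • (S * Q' ^ 2)) - (Complex.I / 2) • (S * Qx') =
      -((1 / 2 : ℂ) • (S * Q ^ 2)) - (Complex.I / 2) • (S * Qx) + C := by
  have e : S * B - B * S = Q' - Q := by rw [hQQ']; abel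
  have key : S * C + C * S = Q * Q - Q' * Q' := by
    calc S * C + C * S = (S * S) * B₁ - B₁ * (S * S) + (S * Q') * B + Q' * B * S - S * B * Q
          - B * (Q * S) := by rw [hC]; noncomm_ring
      _ = -(Q' * (S * B - B * S)) - (S * B - B * S) * Q := by
          rw [hS, hQ', show Q * S = -(S * Q) by rw [hQ, neg_neg]]; noncomm_ring
      _ = _ := by rw [e]; noncomm_ring
  have key' : C + S * C * S = S * Q ^ 2 - S * Q' ^ 2 := by
    calc C + S * C * S = S * (S * C + C * S) := by
          rw [mul_add, ← mul_assoc, hS, one_mul, mul_assoc]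
      _ = _ := by rw [key]; noncomm_ring
  have h3 : S * Qx' = S * Qx + Complex.I • (C - S * C * S) := by
    rw [hx, mul_sub, mul_add, smul_mul_assoc, mul_smul_comm, mul_smul_comm, mul_smul_comm,
      ← mul_assoc, ← mul_assoc, hS, one_mul, smul_sub]
    abel
  rw [h3, smul_add, smul_smul, show Complex.I / 2 * Complex.I = -(1 / 2) by
    rw [div_mul_eq_mul_div, Complex.I_mul_I]; ring]
  have h4 : S * Q' ^ 2 = S * Q ^ 2 - C - S * C * S := by
    rw [sub_sub, key']; abel
  rw [h4]
  module

/-- The zero-curvature expression `Q_t - W_x + i [Q, W]` does not change under the dressing. -/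
theorem zero_curvature_algebra (hQQ' : Q' = Q + S * B - B * S)
    (hQx : Qx = Complex.I • (S * W - W * S)) (hQx' : Qx' = Complex.I • (S * W' - W' * S))
    (hW : W' = W + C) :
    S * (Complex.I • (S * B₂ - B₂ * S + Q' * B₁ - B₁ * Q + W' * B - B * W)) -
      (Complex.I • (S * B₂ - B₂ * S + Q' * B₁ - B₁ * Q + W' * B - B * W)) * S -
      (S * (Complex.I • (S * B₂ - B₂ * S + Q' * B₁ - B₁ * Q)) -
        (Complex.I • (S * B₂ - B₂ * S + Q' * B₁ - B₁ * Q)) * S +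
        (Qx' * B + Q' * (Complex.I • C)) - ((Complex.I • C) * Q + B * Qx)) +
      Complex.I • (Q' * W' - W' * Q') = Complex.I • (Q * W - W * Q) := by
  obtain rfl : C = W' - W := by rw [hW]; abel
  rw [hQx, hQx', hQQ']
  simp only [mul_add, add_mul, mul_sub, sub_mul, smul_mul_assoc, mul_smul_comm, mul_assoc,
    smul_add, smul_sub]
  module

theorem intertwine_algebra_x {F : Matrix m m ℂ} (hQQ' : Q' = Q + S * B - B * S) (μ : ℂ) :
    0 - Complex.I • (S * (μ • F - B) - (μ • F - B) * S + Q' * F - F * Q) =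
      (Complex.I • (μ • S + Q')) * (1 - F) - (1 - F) * (Complex.I • (μ • S + Q)) := by
  have e : B * S = Q + S * B - Q' := by rw [hQQ']; abel
  simp only [mul_add, add_mul, mul_sub, sub_mul, smul_mul_assoc, mul_smul_comm,
    smul_add, smul_sub, mul_one, one_mul, e]
  module

theorem intertwine_algebra_t {F : Matrix m m ℂ} (hQQ' : Q' = Q + S * B - B * S)
    (hC : C = S * B₁ - B₁ * S + Q' * B - B * Q) (hW : W' = W + C) (μ : ℂ) :
    0 - Complex.I • (S * (μ ^ 2 • F - μ • B - B₁) - (μ ^ 2 • F - μ • B - B₁) * S +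
        Q' * (μ • F - B) - (μ • F - B) * Q + W' * F - F * W) =
      (Complex.I • (μ ^ 2 • S + μ • Q' + W')) * (1 - F) -
        (1 - F) * (Complex.I • (μ ^ 2 • S + μ • Q + W)) := by
  have e : B * S = Q + S * B - Q' := by rw [hQQ']; abel
  have e' : B₁ * S = S * B₁ + Q' * B - B * Q - (W' - W) := by rw [hW, hC]; abel
  simp only [mul_add, add_mul, mul_sub, sub_mul, smul_mul_assoc, mul_smul_comm,
    smul_add, smul_sub, mul_one, one_mul, e, e']
  module

end DressedAlgebra

/-- `Q_x` is recovered from `W`, because `σ₃ Q²` commutes with `σ₃` and `σ₃ Q_x` anticommutes. -/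
theorem lowV_commutator {n : ℕ} (q : ℝ → ℝ → Fin n → ℂ) (x t : ℝ) :
    potential (deriv (fun s : ℝ => q s t) x) =
      Complex.I • (sigma3 n * lowV q x t - lowV q x t * sigma3 n) := by
  have hS := sigma3_mul_self n
  have h := sigma3_mul_potential (q x t)
  have h' := sigma3_mul_potential (deriv (fun s : ℝ => q s t) x)
  simp only [lowV]
  set Q := potential (q x t)
  set Qx := potential (deriv (fun s : ℝ => q s t) x)
  set S := sigma3 n
  have e1 : S * Q ^ 2 * S = Q ^ 2 := by
    calc S * Q ^ 2 * S = (S * Q) * (Q * S) := by noncomm_ring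
      _ = Q * (S * -(Q * S)) := by rw [h]; noncomm_ring
      _ = Q * (S * S) * Q := by rw [← h]; noncomm_ring
      _ = Q ^ 2 := by rw [hS]; noncomm_ring
  have e2 : S * Qx * S = -Qx := by
    rw [h', neg_mul, mul_assoc, hS, mul_one]
  have e3 : ∀ X, S * (S * X) = X := fun X => by rw [← mul_assoc, hS, one_mul]
  simp only [mul_sub, sub_mul, mul_neg, neg_mul, mul_smul_comm, smul_mul_assoc, e1, e2, e3,
    smul_sub, smul_neg, smul_smul]
  rw [show Complex.I * (Complex.I / 2) = -(1 / 2) by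
    rw [← mul_div_assoc, Complex.I_mul_I]; ring]
  module

theorem lowV_inr_inl {n : ℕ} (q : ℝ → ℝ → Fin n → ℂ) (x t : ℝ) (j : Fin n) :
    lowV q x t (Sum.inr j) (Sum.inl ()) =
      Complex.I / 2 * deriv (fun s : ℝ => q s t) x j := by
  simp [lowV, sigma3, potential, sq, Matrix.fromBlocks_multiply]

theorem lowV_inl_inl {n : ℕ} (q : ℝ → ℝ → Fin n → ℂ) (x t : ℝ) :
    lowV q x t (Sum.inl ()) (Sum.inl ()) = -(1 / 2 * ∑ k, star (q x t k) * q x t k) := by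
  simp [lowV, sigma3, potential, sq, Matrix.fromBlocks_multiply, Matrix.mul_apply]

theorem lowV_inr_inr {n : ℕ} (q : ℝ → ℝ → Fin n → ℂ) (x t : ℝ) (j k : Fin n) :
    lowV q x t (Sum.inr j) (Sum.inr k) = 1 / 2 * (q x t j * star (q x t k)) := by
  simp [lowV, sigma3, potential, sq, Matrix.fromBlocks_multiply, Matrix.mul_apply]

/-- The lower left block of `[Q, W]` is the cubic term of the NLS equation, with a minus sign. -/
theorem commutator_potential_lowV_inr_inl {n : ℕ} (q : ℝ → ℝ → Fin n → ℂ) (x t : ℝ) (j : Fin n) :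
    (potential (q x t) * lowV q x t - lowV q x t * potential (q x t)) (Sum.inr j) (Sum.inl ()) =
      -(((∑ j, ‖q x t j‖ ^ 2 : ℝ) : ℂ) * q x t j) := by
  have e : ∑ k, star (q x t k) * q x t k = ((∑ j, ‖q x t j‖ ^ 2 : ℝ) : ℂ) := by
    push_cast
    exact Finset.sum_congr rfl fun k _ => Complex.conj_mul' _
  have e1 : potential (q x t) (Sum.inr j) (Sum.inl ()) = q x t j := rfl
  have e2 : ∀ k, potential (q x t) (Sum.inr j) (Sum.inr k) = 0 := fun _ => rfl
  have e3 : potential (q x t) (Sum.inl ()) (Sum.inl ()) = 0 := rfl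
  have e4 : ∀ k, potential (q x t) (Sum.inr k) (Sum.inl ()) = q x t k := fun _ => rfl
  simp only [Matrix.sub_apply, Matrix.mul_apply, Fintype.sum_sum_type, Finset.univ_unique,
    Finset.sum_singleton, PUnit.default_eq_unit, e1, e2, e3, e4, zero_mul, mul_zero,
    Finset.sum_const_zero, add_zero, zero_add, lowV_inl_inl, lowV_inr_inr]
  have e5 : ∑ k, 1 / 2 * (q x t j * star (q x t k)) * q x t k =
      1 / 2 * q x t j * ∑ k, star (q x t k) * q x t k := by
    rw [Finset.mul_sum]
    exact Finset.sum_congr rfl fun k _ => by ring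
  rw [e5, e]
  ring

/-! ### The new potential and the Darboux matrix -/

section Main

variable {n k : ℕ} {q : ℝ → ℝ → Fin n → ℂ}
  {Φ : ℂ → ℝ → ℝ → Matrix (Idx n) (Idx n) ℂ} {v : ℂ → Idx n → ℂ} {lam : Fin k → ℂ}
  {r : Fin k → ℕ}

/-- The dressing matrix `Y M⁻¹ Z Y†` with a constant weight `Z`. Weight `1` gives the new potential
and weight `matD` the Darboux matrix. -/
noncomputable def dress (Φ : ℂ → ℝ → ℝ → Matrix (Idx n) (Idx n) ℂ) (v : ℂ → Idx n → ℂ)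
    (lam : Fin k → ℂ) (r : Fin k → ℕ)
    (Z : Matrix (Σ i : Fin k, Fin (r i)) (Σ i : Fin k, Fin (r i)) ℂ) (x t : ℝ) :
    Matrix (Idx n) (Idx n) ℂ :=
  matY Φ v lam r x t * (matM Φ v lam r x t)⁻¹ * Z * (matY Φ v lam r x t)ᴴ

theorem dress_sub (Z Z' : Matrix (Σ i : Fin k, Fin (r i)) (Σ i : Fin k, Fin (r i)) ℂ) (x t : ℝ) :
    dress Φ v lam r (Z - Z') x t = dress Φ v lam r Z x t - dress Φ v lam r Z' x t := by
  simp only [dress, Matrix.mul_sub, Matrix.sub_mul]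

theorem dress_smul (c : ℂ) (Z : Matrix (Σ i : Fin k, Fin (r i)) (Σ i : Fin k, Fin (r i)) ℂ)
    (x t : ℝ) : dress Φ v lam r (c • Z) x t = c • dress Φ v lam r Z x t := by
  simp only [dress, Matrix.mul_smul, Matrix.smul_mul]

/-- `B = Y M⁻¹ Y†` is skew-Hermitian, because `M` is. -/
theorem dress_one_conjTranspose (hlam : ∀ i j, lam i ≠ star (lam j)) (x t : ℝ) :
    (dress Φ v lam r 1 x t)ᴴ = -dress Φ v lam r 1 x t := by
  have h : (matM Φ v lam r x t)⁻¹ᴴ = -(matM Φ v lam r x t)⁻¹ := by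
    rw [Matrix.conjTranspose_nonsing_inv, matM_conjTranspose hlam]
    -- for singular `M` both inverses are zero by convention
    by_cases hu : IsUnit (matM Φ v lam r x t).det
    · exact Matrix.inv_eq_right_inv (by rw [neg_mul_neg, Matrix.mul_nonsing_inv _ hu])
    · have hu' : ¬IsUnit (-matM Φ v lam r x t).det := by
        rwa [← Matrix.isUnit_iff_isUnit_det, IsUnit.neg_iff, Matrix.isUnit_iff_isUnit_det]
      rw [Matrix.nonsing_inv_apply_not_isUnit _ hu, Matrix.nonsing_inv_apply_not_isUnit _ hu',
        neg_zero]
  simp only [dress, Matrix.mul_one, Matrix.conjTranspose_mul, Matrix.conjTranspose_conjTranspose,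
    h, Matrix.neg_mul, Matrix.mul_neg, Matrix.mul_assoc]

theorem newPotential_eq (x t : ℝ) (j : Fin n) : newPotential Φ v lam r q x t j =
    q x t j - 2 * dress Φ v lam r 1 x t (Sum.inr j) (Sum.inl ()) := by
  rw [dress, Matrix.mul_one]; rfl

/-- `Q' = Q + [σ₃, B]`: the two off-diagonal blocks of the commutator are adjoint to each other
because `B` is skew-Hermitian. -/
theorem potential_newPotential (hlam : ∀ i j, lam i ≠ star (lam j)) (x t : ℝ) :
    potential (newPotential Φ v lam r q x t) = potential (q x t) +
      sigma3 n * dress Φ v lam r 1 x t - dress Φ v lam r 1 x t * sigma3 n := by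
  have h : ∀ a b, star (dress Φ v lam r 1 x t b a) = -dress Φ v lam r 1 x t a b := fun a b =>
    congrFun (congrFun (dress_one_conjTranspose hlam x t) a) b
  have hd : sigma3 n = Matrix.diagonal (Sum.elim (fun _ => 1) fun _ => -1) := by
    rw [sigma3, ← Matrix.diagonal_one, ← Matrix.diagonal_one, Matrix.diagonal_neg,
      Matrix.fromBlocks_diagonal]
  ext a b
  simp only [Matrix.sub_apply, Matrix.add_apply, hd, Matrix.diagonal_mul, Matrix.mul_diagonal]
  rcases a with a | a <;> rcases b with b | b
  · simp [potential]
  · have : potential (newPotential Φ v lam r q x t) (Sum.inl a) (Sum.inr b) =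
        star (newPotential Φ v lam r q x t b) := rfl
    rw [this, newPotential_eq, star_sub, star_mul, h]
    simp [potential]
    ring
  · have : potential (newPotential Φ v lam r q x t) (Sum.inr a) (Sum.inl b) =
        newPotential Φ v lam r q x t a := rfl
    rw [this, newPotential_eq]
    simp [potential]
    ring
  · simp [potential]

/-- By Sylvester's determinant identity `det T` is the determinant of
`1 - M⁻¹ D Y† Y = M⁻¹ D M (μ - Λ)`. -/
theorem det_matT_ne_zero (hlam : ∀ i j, lam i ≠ star (lam j)) {x t : ℝ}
    (hdet : (matM Φ v lam r x t).det ≠ 0) {μ : ℂ} (hμ : ∀ i, μ ≠ star (lam i))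
    (hμ' : ∀ i, μ ≠ lam i) : (matT Φ v lam r μ x t).det ≠ 0 := by
  have hu := isUnit_iff_ne_zero.2 hdet
  have hD := sub_jordan_mul_matD (r := r) hμ
  rw [matT, Matrix.mul_assoc, Matrix.mul_assoc, Matrix.det_one_sub_mul_comm]
  set M := matM Φ v lam r x t
  set D := matD lam r μ
  set J := jordan lam r
  have h : 1 - M⁻¹ * (D * (matY Φ v lam r x t)ᴴ) * matY Φ v lam r x t =
      M⁻¹ * D * M * (μ • 1 - J) := by
    have hD' : D * (μ • 1 - Jᴴ) = 1 := mul_eq_one_comm.1 hD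
    have e1 : D * Jᴴ = μ • D - 1 := by
      rw [← hD', Matrix.mul_sub, Matrix.mul_smul, Matrix.mul_one]; abel
    calc _ = 1 - M⁻¹ * (D * (M * J - Jᴴ * M)) := by
          rw [sylvester_matM hlam]; simp only [Matrix.mul_assoc]
      _ = 1 - M⁻¹ * (D * (M * J)) + M⁻¹ * (D * Jᴴ * M) := by
          rw [Matrix.mul_sub, Matrix.mul_sub, Matrix.mul_assoc D]; abel
      _ = _ := by
          rw [e1, Matrix.sub_mul, Matrix.mul_sub, Matrix.one_mul, Matrix.nonsing_inv_mul _ hu]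
          simp only [Matrix.mul_sub, Matrix.mul_smul, Matrix.smul_mul, Matrix.mul_one,
            Matrix.mul_assoc]
          abel
  have hdD : D.det ≠ 0 := fun h0 => by
    have := congrArg Matrix.det hD
    rw [Matrix.det_mul, h0, mul_zero, Matrix.det_one] at this
    exact zero_ne_one this
  rw [h, Matrix.det_mul, Matrix.det_mul, Matrix.det_mul]
  exact mul_ne_zero (mul_ne_zero (mul_ne_zero
    (Matrix.isUnit_nonsing_inv_det _ hu).ne_zero hdD) hdet) (det_sub_jordan_ne_zero hμ')

theorem matD_mul_jordan {μ : ℂ} (hμ : ∀ i, μ ≠ star (lam i)) :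
    matD lam r μ * (jordan lam r)ᴴ = μ • matD lam r μ - 1 := by
  have h : matD lam r μ * (μ • 1 - (jordan lam r)ᴴ) = 1 :=
    mul_eq_one_comm.1 (sub_jordan_mul_matD hμ)
  rw [← h, Matrix.mul_sub, Matrix.mul_smul, Matrix.mul_one]
  abel

theorem jordan_mul_matD {μ : ℂ} (hμ : ∀ i, μ ≠ star (lam i)) :
    (jordan lam r)ᴴ * matD lam r μ = matD lam r μ * (jordan lam r)ᴴ := by
  rw [matD_mul_jordan hμ, ← sub_jordan_mul_matD hμ, Matrix.sub_mul, Matrix.smul_mul,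
    Matrix.one_mul]
  abel

/-- The matrix `C = [σ₃, B₁] + Q' B - B Q`, where `B` and `B₁` are the dressing matrices of weights
`1` and `Λ†` (`Λ` the Jordan matrix). It satisfies `B_x = i C`. -/
noncomputable def dressC (q : ℝ → ℝ → Fin n → ℂ) (Φ : ℂ → ℝ → ℝ → Matrix (Idx n) (Idx n) ℂ)
    (v : ℂ → Idx n → ℂ) (lam : Fin k → ℂ) (r : Fin k → ℕ) (x t : ℝ) : Matrix (Idx n) (Idx n) ℂ :=
  sigma3 n * dress Φ v lam r (jordan lam r)ᴴ x t - dress Φ v lam r (jordan lam r)ᴴ x t * sigma3 n +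
    potential (newPotential Φ v lam r q x t) * dress Φ v lam r 1 x t -
    dress Φ v lam r 1 x t * potential (q x t)

variable (hq : ContDiff ℝ ∞ (fun z : ℝ × ℝ => q z.1 z.2))
  (hΦ : ∀ x t a b, Differentiable ℂ (fun μ => Φ μ x t a b))
  (hLax : ∀ μ x t, SolvesLaxAt q μ (Φ μ) x t) (hv : ∀ i, AnalyticAt ℂ v (lam i))
  (hlam : ∀ i j, lam i ≠ star (lam j))
  {Z : Matrix (Σ i : Fin k, Fin (r i)) (Σ i : Fin k, Fin (r i)) ℂ}
  {x t : ℝ} (hdet : (matM Φ v lam r x t).det ≠ 0)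

include hq hΦ hLax hv in
theorem eventually_det_matM_ne_zero {x t : ℝ} (hdet : (matM Φ v lam r x t).det ≠ 0) :
    ∀ᶠ s in 𝓝 x, (matM Φ v lam r s t).det ≠ 0 :=
  (entryContDiffAt_matM_fst hq hΦ hLax hv x t).det.continuousAt.eventually_ne hdet

include hq hΦ hLax hv hlam hdet

theorem hasEntryDerivAt_dress_fst (hZ : (jordan lam r)ᴴ * Z = Z * (jordan lam r)ᴴ) :
    HasEntryDerivAt (fun s => dress Φ v lam r Z s t)
      (Complex.I • (sigma3 n * dress Φ v lam r (Z * (jordan lam r)ᴴ) x t -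
        dress Φ v lam r (Z * (jordan lam r)ᴴ) x t * sigma3 n +
        potential (newPotential Φ v lam r q x t) * dress Φ v lam r Z x t -
        dress Φ v lam r Z x t * potential (q x t))) x := by
  have hu := isUnit_iff_ne_zero.2 hdet
  have hY := hasEntryDerivAt_matY_fst (r := r) hq hΦ hLax hv x t
  have hM := (hasEntryDerivAt_matM_fst (r := r) hq hΦ hLax hv hlam x t).inv
    (entryContDiffAt_matM_fst hq hΦ hLax hv x t) (by simp) hdet
  have h := ((hY.mul hM).mul_const Z).mul hY.conjTranspose
  rw [dress_algebra_x (sigma3_conjTranspose n) (potential_conjTranspose _)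
    (Matrix.nonsing_inv_mul _ hu) (Matrix.mul_nonsing_inv _ hu) (sylvester_matM hlam x t) hZ] at h
  rw [potential_newPotential hlam]
  exact h

theorem hasEntryDerivAt_dress_snd (hZ : (jordan lam r)ᴴ * Z = Z * (jordan lam r)ᴴ) :
    HasEntryDerivAt (fun s => dress Φ v lam r Z x s)
      (Complex.I • (sigma3 n * dress Φ v lam r (Z * (jordan lam r)ᴴ * (jordan lam r)ᴴ) x t -
        dress Φ v lam r (Z * (jordan lam r)ᴴ * (jordan lam r)ᴴ) x t * sigma3 n +
        potential (newPotential Φ v lam r q x t) * dress Φ v lam r (Z * (jordan lam r)ᴴ) x t -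
        dress Φ v lam r (Z * (jordan lam r)ᴴ) x t * potential (q x t) +
        (lowV q x t + dressC q Φ v lam r x t) * dress Φ v lam r Z x t -
        dress Φ v lam r Z x t * lowV q x t)) t := by
  have hu := isUnit_iff_ne_zero.2 hdet
  have hY := hasEntryDerivAt_matY_snd (r := r) hq hΦ hLax hv x t
  have hM := (hasEntryDerivAt_matM_snd (r := r) hq hΦ hLax hv hlam x t).inv
    (entryContDiffAt_matM_snd hq hΦ hLax hv x t) (by simp) hdet
  have h := ((hY.mul hM).mul_const Z).mul hY.conjTranspose
  rw [dress_algebra_t (sigma3_conjTranspose n) (potential_conjTranspose _)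
    (lowV_conjTranspose _ _ _) (Matrix.nonsing_inv_mul _ hu) (Matrix.mul_nonsing_inv _ hu)
    (sylvester_matM hlam x t) hZ] at h
  rw [dressC, potential_newPotential hlam]
  exact h

theorem hasEntryDerivAt_dress_one_fst : HasEntryDerivAt (fun s => dress Φ v lam r 1 s t)
    (Complex.I • dressC q Φ v lam r x t) x := by
  have h := hasEntryDerivAt_dress_fst (Z := 1) hq hΦ hLax hv hlam hdet (by simp)
  simp only [Matrix.one_mul] at h
  exact h

omit hlam in
theorem contDiffAt_newPotential :
    ContDiffAt ℝ ∞ (fun z : ℝ × ℝ => newPotential Φ v lam r q z.1 z.2) (x, t) := by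
  have hY := entryContDiffAt_matY (r := r) hq hΦ hLax hv (x, t)
  have hB : EntryContDiffAt ∞ (fun z : ℝ × ℝ => dress Φ v lam r 1 z.1 z.2) (x, t) :=
    ((hY.mul ((entryContDiffAt_matM hq hΦ hLax hv (x, t)).inv hdet)).mul
      (EntryContDiffAt.const 1)).mul hY.conjTranspose
  refine contDiffAt_pi.2 fun j => ?_
  simp only [newPotential_eq]
  exact (contDiffAt_pi.1 hq.contDiffAt j).sub (contDiffAt_const.mul (hB _ _))

theorem potential_deriv_newPotential :
    potential (deriv (fun s => newPotential Φ v lam r q s t) x) =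
      potential (deriv (fun s => q s t) x) + sigma3 n * (Complex.I • dressC q Φ v lam r x t) -
        (Complex.I • dressC q Φ v lam r x t) * sigma3 n := by
  have h₁ := hasEntryDerivAt_potential
    (hasDerivAt_fst_of_contDiffAt (contDiffAt_newPotential hq hΦ hLax hv hdet))
  simp only [potential_newPotential hlam] at h₁
  have hB := hasEntryDerivAt_dress_one_fst hq hΦ hLax hv hlam hdet
  exact h₁.unique (((hasEntryDerivAt_potential (hasDerivAt_fst_of_contDiffAt
    (hq.contDiffAt (x := (x, t))))).add (hB.const_mul _)).sub (hB.mul_const _))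

/-- The `λ`-independent part of the temporal Lax matrix of the new potential is `W + C`. -/
theorem lowV_newPotential :
    lowV (newPotential Φ v lam r q) x t = lowV q x t + dressC q Φ v lam r x t :=
  lowV_algebra (sigma3_mul_self n) (sigma3_mul_potential _) (sigma3_mul_potential _)
    (potential_newPotential hlam x t) rfl
    (potential_deriv_newPotential hq hΦ hLax hv hlam hdet)

theorem intertwinesLaxAt_matT {μ : ℂ} (hμ : ∀ i, μ ≠ star (lam i)) :
    IntertwinesLaxAt q (newPotential Φ v lam r q) μ (matT Φ v lam r μ) x t := by
  have hZ := jordan_mul_matD (r := r) hμ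
  have e₁ : dress Φ v lam r (matD lam r μ * (jordan lam r)ᴴ) x t =
      μ • dress Φ v lam r (matD lam r μ) x t - dress Φ v lam r 1 x t := by
    rw [matD_mul_jordan hμ, dress_sub, dress_smul]
  have e₂ : dress Φ v lam r (matD lam r μ * (jordan lam r)ᴴ * (jordan lam r)ᴴ) x t =
      μ ^ 2 • dress Φ v lam r (matD lam r μ) x t - μ • dress Φ v lam r 1 x t -
        dress Φ v lam r (jordan lam r)ᴴ x t := by
    rw [matD_mul_jordan hμ, Matrix.sub_mul, Matrix.smul_mul, matD_mul_jordan hμ, Matrix.one_mul,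
      dress_sub, dress_smul, dress_sub, dress_smul, smul_sub, smul_smul, sq]
  have hx := (HasEntryDerivAt.const 1 x).sub
    (hasEntryDerivAt_dress_fst hq hΦ hLax hv hlam hdet hZ)
  have ht := (HasEntryDerivAt.const 1 t).sub
    (hasEntryDerivAt_dress_snd hq hΦ hLax hv hlam hdet hZ)
  rw [e₁, intertwine_algebra_x (potential_newPotential hlam x t)] at hx
  rw [e₁, e₂, ← lowV_newPotential hq hΦ hLax hv hlam hdet,
    intertwine_algebra_t (potential_newPotential hlam x t) rfl
      (lowV_newPotential hq hΦ hLax hv hlam hdet), ← laxV_eq, ← laxV_eq] at ht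
  exact ⟨hx, ht⟩

theorem solvesLaxAt_matT_mul {μ : ℂ} (hμ : ∀ i, μ ≠ star (lam i)) :
    SolvesLaxAt (newPotential Φ v lam r q) μ
      (fun y s => matT Φ v lam r μ y s * Φ μ y s) x t := by
  obtain ⟨hx, ht⟩ := intertwinesLaxAt_matT hq hΦ hLax hv hlam hdet hμ
  have hx' := HasEntryDerivAt.mul hx (hLax μ x t).1
  have ht' := HasEntryDerivAt.mul (A := fun s => matT Φ v lam r μ x s) ht
    (B := fun s => Φ μ x s) (hLax μ x t).2
  simp only [Matrix.sub_mul, Matrix.mul_assoc, sub_add_cancel] at hx' ht'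
  exact ⟨hx', ht'⟩

/-- The zero-curvature expressions of the old and the new potential agree, and their lower left
blocks are the NLS expressions. -/
theorem solvesNLSAt_newPotential (hNLS : SolvesNLSAt q x t) :
    SolvesNLSAt (newPotential Φ v lam r q) x t := by
  have hq' := contDiffAt_newPotential hq hΦ hLax hv hdet
  have hqs := hq.contDiffAt (x := (x, t))
  have hW := lowV_newPotential hq hΦ hLax hv hlam hdet
  have hB := hasEntryDerivAt_dress_one_fst hq hΦ hLax hv hlam hdet
  have hBt := hasEntryDerivAt_dress_snd (Z := 1) hq hΦ hLax hv hlam hdet (by simp)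
  have hB₁ := hasEntryDerivAt_dress_fst (Z := (jordan lam r)ᴴ) hq hΦ hLax hv hlam hdet rfl
  simp only [Matrix.one_mul, ← hW] at hBt
  have hQ := hasEntryDerivAt_potential (hasDerivAt_fst_of_contDiffAt hqs)
  have hQ' := hasEntryDerivAt_potential (hasDerivAt_fst_of_contDiffAt hq')
  obtain ⟨E, C', hE, hC, hid⟩ : ∃ E C' : Matrix (Idx n) (Idx n) ℂ,
      HasEntryDerivAt (fun s => sigma3 n * dress Φ v lam r 1 x s -
        dress Φ v lam r 1 x s * sigma3 n) E t ∧
      HasEntryDerivAt (fun s => dressC q Φ v lam r s t) C' x ∧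
      E - C' + Complex.I • (potential (newPotential Φ v lam r q x t) *
          lowV (newPotential Φ v lam r q) x t - lowV (newPotential Φ v lam r q) x t *
          potential (newPotential Φ v lam r q x t)) =
        Complex.I • (potential (q x t) * lowV q x t - lowV q x t * potential (q x t)) :=
    ⟨_, _, (hBt.const_mul (sigma3 n)).sub (hBt.mul_const (sigma3 n)),
      (((hB₁.const_mul (sigma3 n)).sub (hB₁.mul_const (sigma3 n))).add (hQ'.mul hB)).sub
        (hB.mul hQ),
      zero_curvature_algebra (potential_newPotential hlam x t)
        (lowV_commutator q x t) (lowV_commutator (newPotential Φ v lam r q) x t) hW⟩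
  -- the equation is the lower left block of the zero-curvature identity
  funext j
  have ht : deriv (fun s => newPotential Φ v lam r q x s) t j = deriv (fun s => q x s) t j +
      E (Sum.inr j) (Sum.inl ()) := by
    have h := (hasEntryDerivAt_potential (hasDerivAt_snd_of_contDiffAt hqs)).add hE
    simp only [← add_sub_assoc, ← potential_newPotential hlam] at h
    exact (hasEntryDerivAt_potential (hasDerivAt_snd_of_contDiffAt hq') (Sum.inr j)
      (Sum.inl ())).unique (h (Sum.inr j) (Sum.inl ()))
  have hx : Complex.I / 2 * deriv (fun s => deriv (fun y => newPotential Φ v lam r q y t) s) x j =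
      Complex.I / 2 * deriv (fun s => deriv (fun y => q y t) s) x j +
        C' (Sum.inr j) (Sum.inl ()) :=
    ((hasDerivAt_pi.1 (hasDerivAt_deriv_of_contDiffAt hq') j).const_mul (Complex.I / 2)).unique <|
      (((hasDerivAt_pi.1 (hasDerivAt_deriv_of_contDiffAt hqs) j).const_mul (Complex.I / 2)).add
        (hC (Sum.inr j) (Sum.inl ()))).congr_of_eventuallyEq <| by
          filter_upwards [eventually_det_matM_ne_zero hq hΦ hLax hv hdet] with s hs
          have h := congrFun (congrFun (lowV_newPotential hq hΦ hLax hv hlam hs) (Sum.inr j))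
            (Sum.inl ())
          rw [lowV_inr_inl, Matrix.add_apply, lowV_inr_inl] at h
          exact h
  have hid' := congrFun (congrFun hid (Sum.inr j)) (Sum.inl ())
  rw [Matrix.add_apply, Matrix.sub_apply, Matrix.smul_apply, Matrix.smul_apply,
    commutator_potential_lowV_inr_inl, commutator_potential_lowV_inr_inl] at hid'
  have hN := congrFun hNLS j
  simp only [Pi.add_apply, Pi.smul_apply, smul_eq_mul, Pi.zero_apply] at hN hid' ⊢
  rw [ht]
  linear_combination (norm := (ring_nf; simp only [Complex.I_sq]; ring))
    Complex.I * hid' + hN - Complex.I * hx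

end Main

end DarbouxNLS

theorem mainTheorem10 {n k : ℕ}
    (q : ℝ → ℝ → Fin n → ℂ)
    (hq : ContDiff ℝ ∞ (fun z : ℝ × ℝ => q z.1 z.2))
    (hNLS : ∀ x t, DarbouxNLS.SolvesNLSAt q x t)
    (Φ : ℂ → ℝ → ℝ → Matrix (DarbouxNLS.Idx n) (DarbouxNLS.Idx n) ℂ)
    (hΦ : ∀ x t a b, Differentiable ℂ (fun μ => Φ μ x t a b))
    (hLax : ∀ μ x t, DarbouxNLS.SolvesLaxAt q μ (Φ μ) x t)
    (lam : Fin k → ℂ) (hinj : Function.Injective lam)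
    (hlam : ∀ i j, lam i ≠ star (lam j))
    (r : Fin k → ℕ) (hr : ∀ i, 1 ≤ r i)
    (v : ℂ → DarbouxNLS.Idx n → ℂ) (hv : ∀ i, AnalyticAt ℂ v (lam i)) :
    (((∀ i, 0 < (lam i).im) ∨ (∀ i, (lam i).im < 0)) →
      (∀ i, Φ (lam i) 0 0 *ᵥ v (lam i) ≠ 0) →
      ∀ x t, (DarbouxNLS.matM Φ v lam r x t).det ≠ 0) ∧
    (∀ x t, (DarbouxNLS.matM Φ v lam r x t).det ≠ 0 →
      ContDiffAt ℝ ∞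
        (fun z : ℝ × ℝ => DarbouxNLS.newPotential Φ v lam r q z.1 z.2) (x, t) ∧
      DarbouxNLS.SolvesNLSAt (DarbouxNLS.newPotential Φ v lam r q) x t ∧
      ∀ μ, (∀ i, μ ≠ star (lam i)) →
        ((∀ i, μ ≠ lam i) → (DarbouxNLS.matT Φ v lam r μ x t).det ≠ 0) ∧
        DarbouxNLS.IntertwinesLaxAt q (DarbouxNLS.newPotential Φ v lam r q) μ
          (DarbouxNLS.matT Φ v lam r μ) x t ∧
        DarbouxNLS.SolvesLaxAt (DarbouxNLS.newPotential Φ v lam r q) μ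
          (fun y s => DarbouxNLS.matT Φ v lam r μ y s * Φ μ y s) x t) := by
  have hskew := fun x t => DarbouxNLS.matM_conjTranspose (Φ := Φ) (v := v) (r := r) hlam x t
  refine ⟨fun _ h0 x t => ?_, fun x t hdet => ⟨?_, ?_, fun μ hμ => ⟨fun hμ' => ?_, ?_, ?_⟩⟩⟩
  · refine DarbouxNLS.det_ne_zero_of_sylvester hinj (DarbouxNLS.sylvester_matM hlam x t)
      (hskew x t) fun c hc h => ?_
    refine DarbouxNLS.phi_zero_ne_zero hq hLax (h0 c.1) x t ?_
    simpa only [DarbouxNLS.matY, Matrix.of_apply, hc] using! h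
  · exact DarbouxNLS.contDiffAt_newPotential hq hΦ hLax hv hdet
  · exact DarbouxNLS.solvesNLSAt_newPotential hq hΦ hLax hv hlam hdet (hNLS x t)
  · exact DarbouxNLS.det_matT_ne_zero hlam hdet hμ hμ'
  · exact DarbouxNLS.intertwinesLaxAt_matT hq hΦ hLax hv hlam hdet hμ
  · exact DarbouxNLS.solvesLaxAt_matT_mul hq hΦ hLax hv hlam hdet hμ
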